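/- Work over $\mathbb{C}$. An algebraic circuit is a directed acyclic graph whose leaves are labelled by variables or constants and whose internal nodes are labelled by $+$ or $\times$ (arbitrary fan-in); its size is its number of wires (edges). A circuit with projection gates may in addition use gates $\mathrm{proj}_{w=b}$, for a variable $w$ and $b\in\{0,1\}$, which replace $w$ by $b$ in the polynomial computed at their single input; it may use auxiliary variables that do not occur in the polynomial finally computed. A circuit is constant-free if the only constants labelling its leaves are $1$ and $-1$. For $n,d\in\mathbb{N}$ let $$I_{n,d}=\Big\{(a_1,\dots,a_n)\in\{0,1,\dots,d\}^n : a_1+\dots+a_n\le d\Big\},\qquad |I_{n,d}|=\binom{n+d}{n},$$ and call $(f(a))_{a\in I_{n,d}}$ the evaluation vector of an $n$-variate polynomial $f$ of total degree at most $d$. **Lemma.** There exists a constant $c$ such that for all large enough $n,d,s\in\mathbb{N}$ with $(nds)^c\le\binom{n+d}{n}$ there is a nonzero polynomial $A$ with integer coefficients in variables $(Z_a)_{a\in I_{n,d}}$ such that 1. $A$ vanishes on the evaluation vector of every $n$-variate polynomial $f\in\mathbb{C}[x_1,\dots,x_n]$ of total degree at most $d$ that is computable by an algebraic circuit (with arbitrary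 constants from $\mathbb{C}$, without projection gates) of size at most $s$; 2. $A$ is multilinear, that is, of degree at most $1$ in each variable; 3. $A$ is computable by a constant-free circuit with projection gates of size at most $(nds)^c$. -/

import Mathlib

namespace AlgebraicCircuit

/-- The label of a node of a circuit over the coefficient ring `R` in the variables `V`, together
with its incoming wires, when the nodes available as children are numbered `0, …, k - 1`.
Sum and product gates have arbitrary nonzero fan-in (the children are `c :: cs`, repetitions being
parallel wires); `proj w b c` is the projection gate that sets the variable `w` to the bit `b` in
the polynomial computed at its child `c`. -/
inductive Gate (R V : Type*) (k : ℕ) where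
  | const (a : R) : Gate R V k
  | var (x : V) : Gate R V k
  | sum (c : Fin k) (cs : List (Fin k)) : Gate R V k
  | prod (c : Fin k) (cs : List (Fin k)) : Gate R V k
  | proj (w : V) (b : Bool) (c : Fin k) : Gate R V k

/-- The number of wires entering a node. -/
def Gate.wires {R V : Type*} {k : ℕ} : Gate R V k → ℕ
  | .const _ => 0
  | .var _ => 0
  | .sum _ cs => cs.length + 1
  | .prod _ cs => cs.length + 1
  | .proj _ _ _ => 1

/-- A circuit, possibly with projection gates: a finite directed acyclic graph whose nodes are
listed in a topological order (the children of node `i` have numbers less than `i`), with a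
designated output node. -/
structure Circuit (R V : Type*) where
  length : ℕ
  gate : (i : Fin length) → Gate R V i
  output : Fin length

open Classical in
/-- The polynomial `p` with the variable `w` set to the bit `b`. -/
noncomputable def projectVar {R V : Type*} [CommSemiring R] (w : V) (b : Bool)
    (p : MvPolynomial V R) : MvPolynomial V R :=
  MvPolynomial.aeval
    (fun x : V => if x = w then (if b then 1 else 0) else (MvPolynomial.X x : MvPolynomial V R)) p

/-- The polynomial computed at a node, given the polynomials computed at its possible children. -/
noncomputable def Gate.apply {R V : Type*} [CommSemiring R] {k : ℕ} (g : Gate R V k)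
    (v : Fin k → MvPolynomial V R) : MvPolynomial V R :=
  match g with
  | .const a => MvPolynomial.C a
  | .var x => MvPolynomial.X x
  | .sum c cs => ((c :: cs).map v).sum
  | .prod c cs => ((c :: cs).map v).prod
  | .proj w b c => projectVar w b (v c)

namespace Circuit

/-- The polynomial computed at a node of a circuit. -/
noncomputable def value {R V : Type*} [CommSemiring R] (Γ : Circuit R V) (i : Fin Γ.length) :
    MvPolynomial V R :=
  (Γ.gate i).apply fun j : Fin i => Γ.value ⟨j, j.2.trans i.2⟩
termination_by i.1
decreasing_by exact j.2

theorem value_eq {R V : Type*} [CommSemiring R] (Γ : Circuit R V) (i : Fin Γ.length) :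
    Γ.value i = (Γ.gate i).apply fun j : Fin i => Γ.value ⟨j, j.2.trans i.2⟩ := by
  rw [value]

/-- The polynomial computed by a circuit. -/
noncomputable def poly {R V : Type*} [CommSemiring R] (Γ : Circuit R V) : MvPolynomial V R :=
  Γ.value Γ.output

/-- The size of a circuit is its number of wires. -/
def size {R V : Type*} (Γ : Circuit R V) : ℕ :=
  ∑ i, (Γ.gate i).wires

/-- The circuit has no projection gates, that is, it is an ordinary algebraic circuit. -/
def ProjectionFree {R V : Type*} (Γ : Circuit R V) : Prop :=
  ∀ i w b c, Γ.gate i ≠ Gate.proj w b c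

/-- The only constants that label nodes of the circuit are `1` and `-1`. -/
def ConstantFree {R V : Type*} [Ring R] (Γ : Circuit R V) : Prop :=
  ∀ i a, Γ.gate i = Gate.const a → a = 1 ∨ a = -1

end Circuit

/-- `f` is computable by an ordinary algebraic circuit of size at most `s`. -/
def ComputableInSize {R V : Type*} [CommSemiring R] (f : MvPolynomial V R) (s : ℕ) : Prop :=
  ∃ Γ : Circuit R V, Γ.ProjectionFree ∧ Γ.size ≤ s ∧ Γ.poly = f

/-- `A` is computable by a constant-free circuit with projection gates of size at most `t`. The
circuit may use, besides the variables of `A`, auxiliary variables numbered by `ℕ`; they do not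
occur in the polynomial that it computes. -/
def ComputableConstantFreeProj {σ : Type*} (A : MvPolynomial σ ℤ) (t : ℕ) : Prop :=
  ∃ Γ : Circuit ℤ (σ ⊕ ℕ),
    Γ.ConstantFree ∧ Γ.size ≤ t ∧ Γ.poly = MvPolynomial.rename Sum.inl A

/-- The interpolating set of all `a ∈ {0, …, d}^n` with `a₁ + ⋯ + aₙ ≤ d`. -/
abbrev EvalPoint (n d : ℕ) : Type :=
  {a : Fin n → ℕ // ∑ i, a i ≤ d}

/-- The vector of evaluations of `f` at the points of the interpolating set. -/
noncomputable def evalVector {n : ℕ} (d : ℕ) (f : MvPolynomial (Fin n) ℂ) : EvalPoint n d → ℂ :=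
  fun a => MvPolynomial.eval (fun i => (a.1 i : ℂ)) f

/-- The evaluation vectors of the `n`-variate polynomials over `ℂ` of degree at most `d` that are
computable by algebraic circuits of size at most `s`. -/
def evalVectors (n d s : ℕ) : Set (EvalPoint n d → ℂ) :=
  {v | ∃ f : MvPolynomial (Fin n) ℂ,
    f.totalDegree ≤ d ∧ ComputableInSize f s ∧ v = evalVector d f}

/-- `A` is an equation for the set `S`: a nonzero polynomial that vanishes on `S`. -/
def IsEquationFor {σ : Type*} (A : MvPolynomial σ ℤ) (S : Set (σ → ℂ)) : Prop :=
  A ≠ 0 ∧ ∀ v ∈ S, MvPolynomial.aeval v A = 0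

/-- Every variable has degree at most one in `A`. -/
def IsMultilinear {σ : Type*} (A : MvPolynomial σ ℤ) : Prop :=
  ∀ i, A.degreeOf i ≤ 1

end AlgebraicCircuit

/-! Put `p = n + s + 2`. A universal straight-line program with `2 * p ^ 2` parameters specializes
to every polynomial with a circuit of size `s` (`ComputableInSize.exists_universal`). Its value at a
point has degree at most `2 ^ p` in the parameters. Choose `K = 16 * p ^ 3 + 1` interpolation points
and look for a multilinear `A` in the corresponding `K` coordinates that vanishes when the values of
the universal program are substituted. It suffices to require this when every parameter is an
integer with `8 * p` bits, because this grid is larger than the degree of the substituted polynomial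
(`sum_universal_eq_zero`). That is a system of `2 ^ (K - 1)` linear equations in the `2 ^ K`
coefficients of `A`. One dummy bit duplicates the equations and makes the matrix `G` square and
singular, and its entries have small circuits.

It remains to write down a kernel vector of `G` explicitly, although its length is exponential. The
division-free Faddeev–LeVerrier iteration `B ↦ t • (G * B) - trace (G * B) • 1` eventually reaches
zero, and its last nonzero matrix is annihilated by the singular `G`; any nonzero column of it
serves (`exists_mul_faddeevLeVerrier_eq_zero`).

Each step is linear in `B`, so the result is a product of exponentially many transition matrices
applied to the starting matrix. As in Savitch's theorem, such a product is found by repeated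
halving: the path of length `2 ^ (q + 1)` is summed over its midpoint. Projection gates sum over the
exponentially many midpoints cheaply, since `f` with `w = 0` plus `f` with `w = 1` reuses the one
circuit for `f` (`Cost.sum_bits`, `exists_cost_timeProd`). A last Boolean sum over the exponent
vectors assembles `A` from its coefficients (`exists_kernel_cost`). -/

namespace AlgebraicCircuit

/-! ### Kernel vectors by the Faddeev–LeVerrier iteration -/

section FaddeevLeVerrier

open Polynomial Matrix

variable {n R : Type*} [Fintype n] [DecidableEq n] [CommRing R]

/-- Jacobi's formula for the characteristic polynomial. -/
theorem derivative_charpoly (G : Matrix n n R) :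
    derivative G.charpoly = (adjugate (charmatrix G)).trace := by
  have key : ∀ i, adjugate (charmatrix G) i i = ∑ σ : Equiv.Perm n,
      ((Equiv.Perm.sign σ : ℤ) : R[X]) *
        ((∏ j ∈ Finset.univ.erase i, charmatrix G j (σ j)) * derivative (charmatrix G i (σ i))) := by
    intro i
    -- The derivative of the entry `(i, σ i)` is `1` if `σ` fixes `i` and `0` otherwise, which has
    -- the same effect as replacing a line of the matrix by a unit vector.
    rw [adjugate_apply, ← det_transpose, det_apply']
    refine Finset.sum_congr rfl fun σ _ => ?_
    congr 1
    rw [← Finset.mul_prod_erase _ _ (Finset.mem_univ i), mul_comm]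
    congr 1
    · refine Finset.prod_congr rfl fun j hj => ?_
      simp [Finset.ne_of_mem_erase hj]
    · by_cases h : σ i = i
      · simp [h, charmatrix_apply_eq]
      · simp [h, charmatrix_apply_ne _ _ _ (Ne.symm h)]
  rw [charpoly, ← det_transpose, det_apply', derivative_sum, trace]
  simp only [diag_apply, key]
  rw [Finset.sum_comm]
  refine Finset.sum_congr rfl fun σ _ => ?_
  rw [← Finset.mul_sum, derivative_mul, derivative_intCast, zero_mul, zero_add,
    derivative_prod_finset]
  rfl

/-- The division-free Faddeev–LeVerrier iteration started at an arbitrary matrix. -/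
def faddeevLeVerrier (G S : Matrix n n R) : ℕ → Matrix n n R
  | 0 => S
  | t + 1 => (t : R) • (G * faddeevLeVerrier G S t) -
      (G * faddeevLeVerrier G S t).trace • (1 : Matrix n n R)

/-- The coefficients of the adjugate of the characteristic matrix. -/
noncomputable def adjCoeff (G : Matrix n n R) (i : ℕ) : Matrix n n R :=
  (matPolyEquiv (adjugate (charmatrix G))).coeff i

theorem adj_mul (G : Matrix n n R) :
    (X - C G) * matPolyEquiv (adjugate (charmatrix G)) =
      matPolyEquiv (G.charpoly • (1 : Matrix n n R[X])) := by
  rw [← matPolyEquiv_charmatrix, ← map_mul, mul_adjugate, charpoly]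

/-- Compare the coefficients of `X ^ (i + 1)` in `(X - G) * adj = charpoly • 1`. -/
theorem adjCoeff_succ (G : Matrix n n R) (i : ℕ) :
    adjCoeff G i = G * adjCoeff G (i + 1) + G.charpoly.coeff (i + 1) • (1 : Matrix n n R) := by
  have h := congrArg (fun p => p.coeff (i + 1)) (adj_mul G)
  simp only [sub_mul, coeff_sub, coeff_X_mul, coeff_C_mul] at h
  rw [sub_eq_iff_eq_add'] at h
  rw [adjCoeff, adjCoeff, h]
  congr 1
  ext a b
  rw [matPolyEquiv_coeff_apply]
  by_cases hab : a = b <;> simp [hab, one_apply]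

theorem adjCoeff_zero (G : Matrix n n R) :
    G * adjCoeff G 0 = -(G.charpoly.coeff 0 • (1 : Matrix n n R)) := by
  have h := congrArg (fun p => p.coeff 0) (adj_mul G)
  simp only [sub_mul, coeff_sub, mul_coeff_zero, coeff_X_zero, zero_mul, coeff_C_zero,
    zero_sub] at h
  rw [adjCoeff, eq_neg_iff_add_eq_zero, ← neg_eq_iff_add_eq_zero, h]
  ext a b
  rw [matPolyEquiv_coeff_apply]
  by_cases hab : a = b <;> simp [hab, one_apply]

theorem trace_adjCoeff (G : Matrix n n R) (i : ℕ) :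
    (adjCoeff G i).trace = G.charpoly.coeff (i + 1) * ((i : R) + 1) := by
  rw [← coeff_derivative, derivative_charpoly, trace, trace, finsetSum_coeff]
  refine Finset.sum_congr rfl fun j _ => ?_
  rw [diag_apply, diag_apply, adjCoeff, matPolyEquiv_coeff_apply]

/-- Holds beyond the degree of the adjugate; `adjCoeff_succ` carries it down to the index `card n`,
because the characteristic polynomial has no coefficients above that. -/
theorem adjCoeff_eq_zero (G : Matrix n n R) {i : ℕ} (hi : Fintype.card n ≤ i) :
    adjCoeff G i = 0 := by
  nontriviality R
  have key : ∀ k i, Fintype.card n ≤ i →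
      (matPolyEquiv (adjugate (charmatrix G))).natDegree < i + k → adjCoeff G i = 0 := by
    intro k
    induction k with
    | zero => intro i _ h; exact coeff_eq_zero_of_natDegree_lt h
    | succ k ih =>
      intro i hi h
      rw [adjCoeff_succ, ih (i + 1) (by omega) (by omega), coeff_eq_zero_of_natDegree_lt]
      · simp
      · rw [charpoly_natDegree_eq_dim]; omega
  exact key _ i hi (Nat.lt_of_succ_le (Nat.le_add_left _ i))

/-- Take traces in the recursion and eliminate the trace of `adjCoeff G i` by Jacobi's formula. -/
theorem trace_mul_adjCoeff (G : Matrix n n R) (i : ℕ) :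
    (G * adjCoeff G i).trace =
      G.charpoly.coeff i * (i - Fintype.card n) := by
  cases i with
  | zero => rw [adjCoeff_zero]; simp [trace_smul, trace_neg]
  | succ i =>
    have h := trace_adjCoeff G i
    rw [adjCoeff_succ, trace_add, trace_smul, trace_one, smul_eq_mul] at h
    push_cast
    linear_combination h

/-- The classical iteration divides by the step number. Multiplying by it instead leaves the
factorial; the starting matrix enters only through one trace, since the factor `t = 0` kills the
first product. -/
theorem faddeevLeVerrier_succ_eq (G S : Matrix n n R) {k i : ℕ} (h : k + 1 + i = Fintype.card n) :
    faddeevLeVerrier G S (k + 1) =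
      (-(G * S).trace * (k.factorial : R)) • adjCoeff G i := by
  nontriviality R
  induction k generalizing i with
  | zero =>
    rw [adjCoeff_succ, adjCoeff_eq_zero G (by omega)]
    have : G.charpoly.coeff (i + 1) = 1 := by
      have := (charpoly_monic G).coeff_natDegree
      rwa [charpoly_natDegree_eq_dim, ← h, show 0 + 1 + i = i + 1 by omega] at this
    simp [faddeevLeVerrier, this]
  | succ k ih =>
    rw [faddeevLeVerrier, ih (i := i + 1) (by omega), adjCoeff_succ G i, Matrix.mul_smul, trace_smul,
      trace_mul_adjCoeff, ← h, Nat.factorial_succ]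
    ext a b
    simp only [Matrix.sub_apply, Matrix.smul_apply, Matrix.add_apply, smul_eq_mul]
    push_cast
    ring

/-- The last step is the Cayley–Hamilton theorem, in the form `G * adjCoeff G 0 = -charpoly.coeff 0
• 1`. -/
theorem faddeevLeVerrier_card_succ (G S : Matrix n n R) [Nonempty n] :
    faddeevLeVerrier G S (Fintype.card n + 1) = 0 := by
  obtain ⟨k, hk⟩ : ∃ k, Fintype.card n = k + 1 :=
    Nat.exists_eq_succ_of_ne_zero Fintype.card_ne_zero
  rw [faddeevLeVerrier, hk, faddeevLeVerrier_succ_eq G S (k := k) (i := 0) (by omega), Matrix.mul_smul,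
    trace_smul, trace_mul_adjCoeff, adjCoeff_zero, hk]
  ext a b
  simp only [Matrix.sub_apply, Matrix.smul_apply, Matrix.neg_apply, smul_eq_mul, Matrix.zero_apply]
  push_cast
  ring

/-- For a singular matrix, the last nonzero matrix of the Faddeev–LeVerrier iteration is
annihilated by the matrix. -/
theorem exists_mul_faddeevLeVerrier_eq_zero [IsDomain R] [CharZero R] [Nonempty n]
    (G S : Matrix n n R)
    (hG : G.det = 0) (hS : (G * S).trace ≠ 0) :
    ∃ r ≤ Fintype.card n, faddeevLeVerrier G S r ≠ 0 ∧ G * faddeevLeVerrier G S r = 0 := by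
  classical
  -- The shift by two keeps the last nonzero index at least `1`, so that the coefficient multiplying
  -- `G * B` in the next step is nonzero.
  have hex : ∃ r, faddeevLeVerrier G S (r + 2) = 0 := by
    obtain ⟨k, hk⟩ : ∃ k, Fintype.card n = k + 1 :=
      Nat.exists_eq_succ_of_ne_zero Fintype.card_ne_zero
    exact ⟨k, by have := faddeevLeVerrier_card_succ G S; rwa [hk] at this⟩
  set r := Nat.find hex with hr
  have h0 : faddeevLeVerrier G S (r + 2) = 0 := Nat.find_spec hex
  have h1 : faddeevLeVerrier G S (r + 1) ≠ 0 := by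
    cases hr' : r with
    | zero =>
      intro h
      obtain ⟨a⟩ := ‹Nonempty n›
      have := congrFun (congrFun h a) a
      simp [faddeevLeVerrier] at this
      exact hS this
    | succ q => exact Nat.find_min hex (m := q) (by omega)
  have hle : r + 1 ≤ Fintype.card n := by
    obtain ⟨k, hk⟩ : ∃ k, Fintype.card n = k + 1 :=
      Nat.exists_eq_succ_of_ne_zero Fintype.card_ne_zero
    have := Nat.find_min' hex (m := k)
      (by have := faddeevLeVerrier_card_succ G S; rwa [hk] at this)
    omega
  refine ⟨r + 1, hle, h1, ?_⟩
  rw [show r + 2 = (r + 1) + 1 from rfl, faddeevLeVerrier, sub_eq_zero] at h0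
  -- Now a multiple of `G * B` equals `trace (G * B) • 1`; a left null vector of `G` forces the
  -- trace to vanish.
  obtain ⟨v, hv, hvG⟩ := exists_vecMul_eq_zero_iff.2 hG
  have h2 : (G * faddeevLeVerrier G S (r + 1)).trace = 0 := by
    have h3 := congrArg (fun M => v ᵥ* M) h0
    simp only [vecMul_smul, ← vecMul_vecMul, hvG, zero_vecMul, smul_zero, vecMul_one] at h3
    obtain ⟨j, hj⟩ := Function.ne_iff.1 hv
    have := congrFun h3 j
    simp only [Pi.zero_apply, Pi.smul_apply, smul_eq_mul] at this
    exact (mul_eq_zero.1 this.symm).resolve_right hj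
  rw [h2, zero_smul] at h0
  exact (smul_eq_zero.1 h0).resolve_left (Nat.cast_ne_zero.2 (Nat.succ_ne_zero r))

end FaddeevLeVerrier

/-! ### Cost calculus for straight-line programs with projections -/

section StraightLine

/-- The integer functions on assignments of the variables `V`, in which the values of circuits are
compared. -/
abbrev PolyFun (V : Type*) : Type _ := (V → ℤ) → ℤ

open Classical in
/-- The function `f` with the variable `w` set to the bit `b`. -/
noncomputable def PolyFun.set {V : Type*} (w : V) (b : Bool) (f : PolyFun V) : PolyFun V :=
  fun τ => f (Function.update τ w (b.toNat : ℤ))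

/-- `Derives F t Q` says that adjoining gates with `t` wires in total to the available functions
`F` makes exactly the functions `Q` available. -/
inductive Derives {V : Type*} (F : Set (PolyFun V)) : ℕ → Set (PolyFun V) → Prop
  | refl : Derives F 0 F
  | one {t Q} : Derives F t Q → Derives F t (insert 1 Q)
  | negOne {t Q} : Derives F t Q → Derives F t (insert (-1) Q)
  | var {t Q} (x : V) : Derives F t Q → Derives F t (insert (fun τ => τ x) Q)
  | sum {t Q} (f : PolyFun V) (l : List (PolyFun V)) : Derives F t Q → (∀ g ∈ f :: l, g ∈ Q) →
      Derives F (t + (l.length + 1)) (insert (f :: l).sum Q)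
  | prod {t Q} (f : PolyFun V) (l : List (PolyFun V)) : Derives F t Q → (∀ g ∈ f :: l, g ∈ Q) →
      Derives F (t + (l.length + 1)) (insert (f :: l).prod Q)
  | set {t Q} (w : V) (b : Bool) (f : PolyFun V) : Derives F t Q → f ∈ Q →
      Derives F (t + 1) (insert (f.set w b) Q)

variable {V : Type*} {F H Q Q' : Set (PolyFun V)} {t t' : ℕ}

theorem Derives.weaken (h : Derives F t Q) (hF : F ⊆ H) :
    ∃ Q', Q ∪ H ⊆ Q' ∧ Derives H t Q' := by
  induction h with
  | refl => exact ⟨H, Set.union_subset hF subset_rfl, .refl⟩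
  | one h ih =>
    obtain ⟨Q', h1, h2⟩ := ih
    exact ⟨_, by rw [Set.insert_union]; exact Set.insert_subset_insert h1, h2.one⟩
  | negOne h ih =>
    obtain ⟨Q', h1, h2⟩ := ih
    exact ⟨_, by rw [Set.insert_union]; exact Set.insert_subset_insert h1, h2.negOne⟩
  | var x h ih =>
    obtain ⟨Q', h1, h2⟩ := ih
    exact ⟨_, by rw [Set.insert_union]; exact Set.insert_subset_insert h1, h2.var x⟩
  | sum f l h hl ih =>
    obtain ⟨Q', h1, h2⟩ := ih
    exact ⟨_, by rw [Set.insert_union]; exact Set.insert_subset_insert h1,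
      h2.sum f l fun g hg => h1 (Or.inl (hl g hg))⟩
  | prod f l h hl ih =>
    obtain ⟨Q', h1, h2⟩ := ih
    exact ⟨_, by rw [Set.insert_union]; exact Set.insert_subset_insert h1,
      h2.prod f l fun g hg => h1 (Or.inl (hl g hg))⟩
  | set w b f h hf ih =>
    obtain ⟨Q', h1, h2⟩ := ih
    exact ⟨_, by rw [Set.insert_union]; exact Set.insert_subset_insert h1,
      h2.set w b f (h1 (Or.inl hf))⟩

theorem Derives.trans (h : Derives F t Q) (h' : Derives Q t' Q') : Derives F (t + t') Q' := by
  induction h' with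
  | refl => exact h
  | one _ ih => exact ih.one
  | negOne _ ih => exact ih.negOne
  | var x _ ih => exact ih.var x
  | sum f l _ hl ih => exact Nat.add_assoc t _ _ ▸ ih.sum f l hl
  | prod f l _ hl ih => exact Nat.add_assoc t _ _ ▸ ih.prod f l hl
  | set w b f _ hf ih => exact Nat.add_assoc t _ _ ▸ ih.set w b f hf

/-- `Builds F t Q` says that the functions `Q` become available when gates with at most `t` wires
are adjoined to the functions `F`. -/
def Builds (F : Set (PolyFun V)) (t : ℕ) (Q : Set (PolyFun V)) : Prop :=
  ∃ t' ≤ t, ∃ Q', Q ⊆ Q' ∧ Derives F t' Q'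

theorem Builds.of_subset (h : Q ⊆ F) (t : ℕ) : Builds F t Q :=
  ⟨0, t.zero_le, F, h, .refl⟩

theorem Builds.mono (h : Builds F t Q) (hF : F ⊆ H) (ht : t ≤ t') (hQ : Q' ⊆ Q) :
    Builds H t' Q' := by
  obtain ⟨s, hs, P, hP, hd⟩ := h
  obtain ⟨P', h1, h2⟩ := hd.weaken hF
  exact ⟨s, hs.trans ht, P', hQ.trans (hP.trans (Set.subset_union_left.trans h1)), h2⟩

/-- The functions in `Q` are paid for once, however often the construction of `Q'` uses them: this
is the sharing in a directed acyclic graph. -/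
theorem Builds.cut (h : Builds F t Q) (h' : Builds (F ∪ Q) t' Q') :
    Builds F (t + t') (Q ∪ Q') := by
  obtain ⟨s, hs, P, hP, hd⟩ := h
  obtain ⟨s', hs', P', hP', hd'⟩ := h'
  obtain ⟨S, h1, h2⟩ := hd.weaken (subset_refl F)
  obtain ⟨S', h3, h4⟩ := hd'.weaken
    (Set.union_subset (Set.subset_union_right.trans h1)
      (hP.trans (Set.subset_union_left.trans h1)))
  exact ⟨s + s', Nat.add_le_add hs hs', S',
    Set.union_subset (hP.trans (Set.subset_union_left.trans (h1.trans
      (Set.subset_union_right.trans h3)))) (hP'.trans (Set.subset_union_left.trans h3)),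
    h2.trans h4⟩

theorem Builds.union (h : Builds F t Q) (h' : Builds F t' Q') : Builds F (t + t') (Q ∪ Q') :=
  h.cut (h'.mono Set.subset_union_left le_rfl subset_rfl)

theorem Builds.iUnion {ι : Type*} (s : Finset ι) (t : ι → ℕ) (Q : ι → Set (PolyFun V))
    (h : ∀ i ∈ s, Builds F (t i) (Q i)) : Builds F (∑ i ∈ s, t i) (⋃ i ∈ s, Q i) := by
  classical
  induction s using Finset.induction_on with
  | empty => exact .of_subset (by simp) _
  | insert a s ha ih =>
    rw [Finset.sum_insert ha, Finset.set_biUnion_insert]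
    exact (h a (Finset.mem_insert_self a s)).union
      (ih fun i hi => h i (Finset.mem_insert_of_mem hi))

/-- `f` becomes available when gates with at most `t` wires are adjoined to the functions `F`. -/
def Cost (F : Set (PolyFun V)) (t : ℕ) (f : PolyFun V) : Prop := Builds F t {f}

variable {f g : PolyFun V}

theorem Cost.mono (h : Cost F t f) (ht : t ≤ t') : Cost F t' f :=
  Builds.mono h subset_rfl ht subset_rfl

theorem Cost.weaken (h : Cost F t f) (hF : F ⊆ H) : Cost H t f :=
  Builds.mono h hF le_rfl subset_rfl

theorem Builds.cost (h : Builds F t Q) (hf : f ∈ Q) : Cost F t f :=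
  h.mono subset_rfl le_rfl (Set.singleton_subset_iff.2 hf)

theorem Cost.of_mem (h : f ∈ F) : Cost F 0 f :=
  Builds.of_subset (Set.singleton_subset_iff.2 h) 0

theorem Cost.one : Cost F 0 1 :=
  ⟨0, le_rfl, _, Set.singleton_subset_iff.2 (Set.mem_insert _ _), Derives.refl.one⟩

theorem Cost.negOne : Cost F 0 (-1) :=
  ⟨0, le_rfl, _, Set.singleton_subset_iff.2 (Set.mem_insert _ _), Derives.refl.negOne⟩

theorem Cost.var (x : V) : Cost F 0 (fun τ => τ x) :=
  ⟨0, le_rfl, _, Set.singleton_subset_iff.2 (Set.mem_insert _ _), Derives.refl.var x⟩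

theorem Cost.set (w : V) (b : Bool) (h : Cost F t f) : Cost F (t + 1) (f.set w b) := by
  obtain ⟨s, hs, P, hP, hd⟩ := h
  exact ⟨s + 1, Nat.add_le_add_right hs 1, _, Set.singleton_subset_iff.2 (Set.mem_insert _ _),
    hd.set w b f (hP rfl)⟩

theorem Builds.sum_list (l : List (PolyFun V)) (h : Builds F t {g | g ∈ l}) (hl : l ≠ []) :
    Cost F (t + l.length) l.sum := by
  obtain ⟨s, hs, P, hP, hd⟩ := h
  cases l with
  | nil => exact absurd rfl hl
  | cons a l =>
    exact ⟨_, Nat.add_le_add_right hs _, _, Set.singleton_subset_iff.2 (Set.mem_insert _ _),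
      hd.sum a l fun g hg => hP hg⟩

theorem Builds.prod_list (l : List (PolyFun V)) (h : Builds F t {g | g ∈ l}) (hl : l ≠ []) :
    Cost F (t + l.length) l.prod := by
  obtain ⟨s, hs, P, hP, hd⟩ := h
  cases l with
  | nil => exact absurd rfl hl
  | cons a l =>
    exact ⟨_, Nat.add_le_add_right hs _, _, Set.singleton_subset_iff.2 (Set.mem_insert _ _),
      hd.prod a l fun g hg => hP hg⟩

theorem Cost.add (h : Cost F t f) (h' : Cost F t' g) : Cost F (t + t' + 2) (f + g) := by
  have := Builds.sum_list [f, g] ((Builds.union h h').mono subset_rfl le_rfl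
    (by rintro x hx; simpa [or_comm] using hx)) (by simp)
  simpa using this

theorem Cost.mul (h : Cost F t f) (h' : Cost F t' g) : Cost F (t + t' + 2) (f * g) := by
  have := Builds.prod_list [f, g] ((Builds.union h h').mono subset_rfl le_rfl
    (by rintro x hx; simpa [or_comm] using hx)) (by simp)
  simpa using this

theorem Cost.neg (h : Cost F t f) : Cost F (t + 2) (-f) := by
  have := (Cost.negOne (F := F)).mul h
  simpa using this

theorem Cost.sub (h : Cost F t f) (h' : Cost F t' g) : Cost F (t + t' + 4) (f - g) := by
  rw [sub_eq_add_neg]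
  exact (h.add h'.neg).mono (by omega)

theorem Cost.zero : Cost F 2 0 := by
  simpa using (Cost.one (F := F)).add Cost.negOne

theorem Cost.finset_sum {ι : Type*} (s : Finset ι) (f : ι → PolyFun V)
    (h : ∀ i ∈ s, Cost F t (f i)) : Cost F (s.card * (t + 1) + 2) (∑ i ∈ s, f i) := by
  rcases s.eq_empty_or_nonempty with rfl | hs
  · exact Cost.zero.mono (by simp)
  · have := Builds.sum_list (s.toList.map f) ((Builds.iUnion s (fun _ => t) _ h).mono
      subset_rfl le_rfl (by rintro x hx; simpa [eq_comm] using hx))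
      (by simpa using hs.ne_empty)
    rw [Finset.sum_map_toList] at this
    refine this.mono ?_
    simp [mul_add]

theorem Cost.finset_prod {ι : Type*} (s : Finset ι) (f : ι → PolyFun V)
    (h : ∀ i ∈ s, Cost F t (f i)) : Cost F (s.card * (t + 1)) (∏ i ∈ s, f i) := by
  rcases s.eq_empty_or_nonempty with rfl | hs
  · exact Cost.one.mono (by simp)
  · have := Builds.prod_list (s.toList.map f) ((Builds.iUnion s (fun _ => t) _ h).mono
      subset_rfl le_rfl (by rintro x hx; simpa [eq_comm] using hx))
      (by simpa using hs.ne_empty)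
    rw [Finset.prod_map_toList] at this
    refine this.mono ?_
    simp [mul_add]

theorem Cost.natCast (m : ℕ) : Cost F (m + 2) (m : PolyFun V) := by
  have := Cost.finset_sum (F := F) (t := 0) (Finset.range m) (fun _ => 1) fun _ _ => Cost.one
  simpa using this

end StraightLine

/-! ### From straight-line programs to circuits -/

section ToCircuit

variable {V W : Type*}

/-- A circuit with one more node, which does not become the output. -/
def Circuit.snoc {R : Type*} (Γ : Circuit R W) (g : Gate R W Γ.length) : Circuit R W where
  length := Γ.length + 1
  gate := Fin.snoc (α := fun i : Fin (Γ.length + 1) => Gate R W i) Γ.gate g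
  output := Γ.output.castSucc

theorem Circuit.snoc_value_castSucc {R : Type*} [CommSemiring R] (Γ : Circuit R W)
    (g : Gate R W Γ.length) (i : Fin Γ.length) :
    (Γ.snoc g).value i.castSucc = Γ.value i := by
  obtain ⟨i, hi⟩ := i
  induction i using Nat.strong_induction_on with
  | _ i ih =>
    refine (Circuit.value_eq (Γ.snoc g) _).trans ((?_ : _ = _).trans (Circuit.value_eq Γ _).symm)
    have : (Γ.snoc g).gate (Fin.castSucc ⟨i, hi⟩) = Γ.gate ⟨i, hi⟩ :=
      Fin.snoc_castSucc (α := fun i : Fin (Γ.length + 1) => Gate R W i) g Γ.gate ⟨i, hi⟩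
    refine (congrArg (Gate.apply · _) this).trans (congrArg _ ?_)
    funext j
    exact ih j j.2 (j.2.trans hi)

theorem Circuit.snoc_value_last {R : Type*} [CommSemiring R] (Γ : Circuit R W)
    (g : Gate R W Γ.length) :
    (Γ.snoc g).value (Fin.last Γ.length) = g.apply Γ.value := by
  refine (Circuit.value_eq (Γ.snoc g) _).trans ?_
  have : (Γ.snoc g).gate (Fin.last Γ.length) = g :=
    Fin.snoc_last (α := fun i : Fin (Γ.length + 1) => Gate R W i) g Γ.gate
  refine (congrArg (Gate.apply · _) this).trans (congrArg _ ?_)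
  funext j
  exact Γ.snoc_value_castSucc g j

theorem Circuit.snoc_size {R : Type*} (Γ : Circuit R W) (g : Gate R W Γ.length) :
    (Γ.snoc g).size = Γ.size + g.wires := by
  rw [Circuit.size, Circuit.size]
  refine (Fin.sum_univ_castSucc (n := Γ.length) _).trans ?_
  congr 1
  · refine Finset.sum_congr rfl fun i _ => ?_
    exact congrArg _ (Fin.snoc_castSucc (α := fun i : Fin (Γ.length + 1) => Gate R W i) g Γ.gate i)
  · exact congrArg _ (Fin.snoc_last (α := fun i : Fin (Γ.length + 1) => Gate R W i) g Γ.gate)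

theorem Circuit.snoc_constantFree {R : Type*} [Ring R] {Γ : Circuit R W} (h : Γ.ConstantFree)
    {g : Gate R W Γ.length} (hg : ∀ a, g = Gate.const a → a = 1 ∨ a = -1) :
    (Γ.snoc g).ConstantFree := by
  intro i
  refine Fin.lastCases ?_ (fun j => ?_) i
  · intro a ha
    exact hg a ((Fin.snoc_last (α := fun i : Fin (Γ.length + 1) => Gate R W i) g Γ.gate).symm.trans
      ha)
  · intro a ha
    exact h j a ((Fin.snoc_castSucc (α := fun i : Fin (Γ.length + 1) => Gate R W i) g Γ.gate
      j).symm.trans ha)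

theorem eval_projectVar [DecidableEq W] (w : W) (b : Bool) (p : MvPolynomial W ℤ) (τ : W → ℤ) :
    MvPolynomial.eval τ (projectVar w b p) =
      MvPolynomial.eval (Function.update τ w (b.toNat : ℤ)) p := by
  induction p using MvPolynomial.induction_on with
  | C a => simp [projectVar]
  | add p q hp hq =>
    rw [map_add, ← hp, ← hq, ← map_add]
    simp [projectVar]
  | mul_X p x hp =>
    rw [map_mul, ← hp]
    simp only [projectVar, map_mul, MvPolynomial.aeval_X, MvPolynomial.eval_X]
    congr 1
    by_cases h : x = w
    · subst h; cases b <;> simp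
    · simp [h]

/-- The functions computed at the nodes of a circuit, read through an embedding of variables. -/
def Circuit.Realizes (Γ : Circuit ℤ W) (e : V → W) (f : PolyFun V) : Prop :=
  ∃ i, ∀ τ, MvPolynomial.eval τ (Γ.value i) = f (τ ∘ e)

theorem Circuit.Realizes.snoc {Γ : Circuit ℤ W} {e : V → W} {f : PolyFun V}
    (h : Γ.Realizes e f) (g : Gate ℤ W Γ.length) : (Γ.snoc g).Realizes e f := by
  obtain ⟨i, hi⟩ := h
  exact ⟨i.castSucc, fun τ => by rw [Γ.snoc_value_castSucc, hi]⟩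

theorem Circuit.realizes_list {Γ : Circuit ℤ W} {e : V → W} (l : List (PolyFun V))
    (h : ∀ f ∈ l, Γ.Realizes e f) :
    ∃ cs : List (Fin Γ.length), cs.length = l.length ∧
      (∀ τ, MvPolynomial.eval τ (cs.map Γ.value).sum = l.sum (τ ∘ e)) ∧
      ∀ τ, MvPolynomial.eval τ (cs.map Γ.value).prod = l.prod (τ ∘ e) := by
  induction l with
  | nil => exact ⟨[], by simp⟩
  | cons f l ih =>
    obtain ⟨cs, h1, h2, h3⟩ := ih fun g hg => h g (List.mem_cons_of_mem f hg)
    obtain ⟨i, hi⟩ := h f List.mem_cons_self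
    refine ⟨i :: cs, by simp [h1], fun τ => ?_, fun τ => ?_⟩
    · simp only [List.map_cons, List.sum_cons, map_add, hi, h2, Pi.add_apply]
    · simp only [List.map_cons, List.prod_cons, map_mul, hi, h3, Pi.mul_apply]

theorem exists_circuit_of_derives {e : V → W} (he : Function.Injective e) {t : ℕ}
    {Q : Set (PolyFun V)} (h : Derives ∅ t Q) :
    ∃ Γ : Circuit ℤ W, Γ.ConstantFree ∧ Γ.size ≤ t ∧ ∀ f ∈ Q, Γ.Realizes e f := by
  have extend : ∀ {Γ : Circuit ℤ W} {Q : Set (PolyFun V)} {t w : ℕ} (f : PolyFun V)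
      (g : Gate ℤ W Γ.length), Γ.ConstantFree → Γ.size ≤ t → (∀ f ∈ Q, Γ.Realizes e f) →
      (∀ a, g = Gate.const a → a = 1 ∨ a = -1) → g.wires ≤ w →
      (∀ τ, MvPolynomial.eval τ (g.apply Γ.value) = f (τ ∘ e)) →
      ∃ Γ : Circuit ℤ W, Γ.ConstantFree ∧ Γ.size ≤ t + w ∧ ∀ h ∈ insert f Q, Γ.Realizes e h := by
    intro Γ Q t w f g h1 h2 h3 h4 h5 h6
    refine ⟨Γ.snoc g, Circuit.snoc_constantFree h1 h4,
      (Γ.snoc_size g).trans_le (Nat.add_le_add h2 h5), ?_⟩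
    rintro k (rfl | hk)
    · exact ⟨Fin.last _, fun τ => by rw [Γ.snoc_value_last, h6]⟩
    · exact (h3 k hk).snoc g
  induction h with
  | refl =>
    -- A circuit needs an output node, so the empty derivation is represented by a dummy constant,
    -- which has no wires.
    refine ⟨⟨1, fun _ => .const 1, 0⟩, ?_, by simp [Circuit.size, Gate.wires], by simp⟩
    rintro i a h
    exact Or.inl (Gate.const.inj h).symm
  | one _ ih =>
    obtain ⟨Γ, h1, h2, h3⟩ := ih
    exact extend (w := 0) 1 (.const 1) h1 h2 h3 (fun a h => Or.inl (Gate.const.inj h).symm) le_rfl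
      fun τ => by simp [Gate.apply]
  | negOne _ ih =>
    obtain ⟨Γ, h1, h2, h3⟩ := ih
    exact extend (w := 0) (-1) (.const (-1)) h1 h2 h3
      (fun a h => Or.inr (Gate.const.inj h).symm) le_rfl fun τ => by simp [Gate.apply]
  | var x _ ih =>
    obtain ⟨Γ, h1, h2, h3⟩ := ih
    exact extend (w := 0) _ (.var (e x)) h1 h2 h3 (fun a h => by cases h) le_rfl
      fun τ => by simp [Gate.apply]
  | sum f l _ hl ih =>
    obtain ⟨Γ, h1, h2, h3⟩ := ih
    obtain ⟨cs, h4, h5, -⟩ := Γ.realizes_list l fun g hg => h3 g (hl g (List.mem_cons_of_mem f hg))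
    obtain ⟨i, hi⟩ := h3 f (hl f List.mem_cons_self)
    refine extend _ (.sum i cs) h1 h2 h3 (fun a h => by cases h) (by simp [Gate.wires, h4])
      fun τ => ?_
    simp only [Gate.apply, List.map_cons, List.sum_cons, map_add, hi, h5, Pi.add_apply]
  | prod f l _ hl ih =>
    obtain ⟨Γ, h1, h2, h3⟩ := ih
    obtain ⟨cs, h4, -, h5⟩ := Γ.realizes_list l fun g hg => h3 g (hl g (List.mem_cons_of_mem f hg))
    obtain ⟨i, hi⟩ := h3 f (hl f List.mem_cons_self)
    refine extend _ (.prod i cs) h1 h2 h3 (fun a h => by cases h) (by simp [Gate.wires, h4])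
      fun τ => ?_
    simp only [Gate.apply, List.map_cons, List.prod_cons, map_mul, hi, h5, Pi.mul_apply]
  | set w b f _ hf ih =>
    obtain ⟨Γ, h1, h2, h3⟩ := ih
    obtain ⟨i, hi⟩ := h3 f hf
    refine extend _ (.proj (e w) b i) h1 h2 h3 (fun a h => by cases h) (by simp [Gate.wires])
      fun τ => ?_
    classical
    rw [Gate.apply, eval_projectVar, hi, PolyFun.set, Function.update_comp_eq_of_injective _ he]

/-- A polynomial whose evaluation function is built from nothing is computed by a constant-free
circuit with projection gates. -/
theorem computable_of_cost {σ ι : Type*} (j : ι → ℕ) (hj : Function.Injective j)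
    (A : MvPolynomial σ ℤ) {t : ℕ}
    (h : Cost ∅ t (fun τ : σ ⊕ ι → ℤ => MvPolynomial.eval (fun i => τ (Sum.inl i)) A)) :
    ComputableConstantFreeProj A t := by
  obtain ⟨s, hs, P, hP, hd⟩ := h
  obtain ⟨Γ, h1, h2, h3⟩ := exists_circuit_of_derives
    (Sum.map_injective.2 ⟨Function.injective_id, hj⟩) hd
  obtain ⟨i, hi⟩ := h3 _ (hP rfl)
  -- Move the output to the node realizing `A`. Over `ℤ` a polynomial is determined by its values,
  -- so working with functions loses nothing.
  refine ⟨⟨Γ.length, Γ.gate, i⟩, h1, h2.trans hs, MvPolynomial.funext fun τ => ?_⟩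
  have : Circuit.poly ⟨Γ.length, Γ.gate, i⟩ = Γ.value i := by
    have : ∀ k : Fin Γ.length, Circuit.value ⟨Γ.length, Γ.gate, i⟩ k = Γ.value k := by
      rintro ⟨k, hk⟩
      induction k using Nat.strong_induction_on with
      | _ k ih =>
        rw [Circuit.value_eq, Circuit.value_eq]
        congr 1
        funext j
        exact ih j j.2 (j.2.trans hk)
    exact this i
  rw [this, hi, MvPolynomial.eval_rename]
  rfl

end ToCircuit

/-! ### A universal straight-line program -/

section Universal

open Finset

variable {S T : Type*} [CommRing S] [CommRing T]

/-- The universal straight-line program: the first `N` values are given, and each later value is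
the product of two linear combinations, with coefficients `α` and `β`, of the previous values. -/
def slp (N : ℕ) (base : ℕ → S) (α β : ℕ → ℕ → S) (m : ℕ) : S :=
  if m < N then base m
  else (∑ j : Fin m, α m j * slp N base α β j) * ∑ j : Fin m, β m j * slp N base α β j
termination_by m

theorem slp_of_lt {N : ℕ} (base : ℕ → S) (α β : ℕ → ℕ → S) {m : ℕ} (h : m < N) :
    slp N base α β m = base m := by
  rw [slp, if_pos h]

theorem slp_of_le {N : ℕ} (base : ℕ → S) (α β : ℕ → ℕ → S) {m : ℕ} (h : N ≤ m) :
    slp N base α β m = (∑ j ∈ range m, α m j * slp N base α β j) *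
      ∑ j ∈ range m, β m j * slp N base α β j := by
  rw [slp, if_neg h.not_gt, Fin.sum_univ_eq_sum_range (fun j => α m j * slp N base α β j),
    Fin.sum_univ_eq_sum_range (fun j => β m j * slp N base α β j)]

theorem slp_congr {N : ℕ} {base base' : ℕ → S} {α β α' β' : ℕ → ℕ → S} {m : ℕ}
    (hb : ∀ k < N, base k = base' k)
    (hα : ∀ k ≤ m, ∀ j < k, α k j = α' k j) (hβ : ∀ k ≤ m, ∀ j < k, β k j = β' k j) :
    slp N base α β m = slp N base' α' β' m := by
  induction m using Nat.strong_induction_on with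
  | _ m ih =>
    by_cases h : m < N
    · rw [slp_of_lt _ _ _ h, slp_of_lt _ _ _ h, hb m h]
    · have h' := not_lt.1 h
      have hih : ∀ j ∈ range m, slp N base α β j = slp N base' α' β' j := fun j hj =>
        ih j (mem_range.1 hj) (fun k hk => hα k (hk.trans (mem_range.1 hj).le))
          fun k hk => hβ k (hk.trans (mem_range.1 hj).le)
      rw [slp_of_le _ _ _ h', slp_of_le _ _ _ h']
      congr 1
      · exact sum_congr rfl fun j hj => by rw [hih j hj, hα m le_rfl j (mem_range.1 hj)]
      · exact sum_congr rfl fun j hj => by rw [hih j hj, hβ m le_rfl j (mem_range.1 hj)]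

theorem map_slp (φ : S →+* T) (N : ℕ) (base : ℕ → S) (α β : ℕ → ℕ → S) (m : ℕ) :
    φ (slp N base α β m) =
      slp N (fun k => φ (base k)) (fun k j => φ (α k j)) (fun k j => φ (β k j)) m := by
  induction m using Nat.strong_induction_on with
  | _ m ih =>
    by_cases h : m < N
    · rw [slp_of_lt _ _ _ h, slp_of_lt _ _ _ h]
    · have h' := not_lt.1 h
      rw [slp_of_le _ _ _ h', slp_of_le _ _ _ h', map_mul, map_sum, map_sum]
      congr 1 <;> exact sum_congr rfl fun j hj => by rw [map_mul, ih j (mem_range.1 hj)]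

/-- Multiplying an earlier value by a coefficient gives degree at most `2 ^ m - 1`, so the product
of two such sums has degree at most `2 ^ (m + 1) - 2`; hence the summand `2`. -/
theorem totalDegree_slp_le {τ : Type*} {N : ℕ} {base : ℕ → MvPolynomial τ S}
    {α β : ℕ → ℕ → MvPolynomial τ S} (hb : ∀ k, (base k).totalDegree = 0)
    (hα : ∀ k j, (α k j).totalDegree ≤ 1) (hβ : ∀ k j, (β k j).totalDegree ≤ 1) (m : ℕ) :
    (slp N base α β m).totalDegree + 2 ≤ 2 ^ (m + 1) := by
  induction m using Nat.strong_induction_on with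
  | _ m ih =>
    by_cases h : m < N
    · rw [slp_of_lt _ _ _ h, hb, zero_add]
      exact Nat.le_self_pow (Nat.succ_ne_zero m) 2
    · have h' := not_lt.1 h
      have key : ∀ γ : ℕ → ℕ → MvPolynomial τ S, (∀ k j, (γ k j).totalDegree ≤ 1) →
          (∑ j ∈ range m, γ m j * slp N base α β j).totalDegree + 1 ≤ 2 ^ m := by
        intro γ hγ
        have hpos : 1 ≤ 2 ^ m := Nat.one_le_two_pow
        suffices (∑ j ∈ range m, γ m j * slp N base α β j).totalDegree ≤ 2 ^ m - 1 by omega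
        refine MvPolynomial.totalDegree_finsetSum_le fun j hj => ?_
        have h1 := ih j (mem_range.1 hj)
        have h2 : 2 ^ (j + 1) ≤ 2 ^ m := Nat.pow_le_pow_right two_pos (mem_range.1 hj)
        have h3 := MvPolynomial.totalDegree_mul (γ m j) (slp N base α β j)
        have h4 := hγ m j
        omega
      rw [slp_of_le _ _ _ h', pow_succ]
      have h1 := key α hα
      have h2 := key β hβ
      have h3 := MvPolynomial.totalDegree_mul (∑ j ∈ range m, α m j * slp N base α β j)
        (∑ j ∈ range m, β m j * slp N base α β j)
      omega

/-- The values with which the universal program starts: `1` and the variables. -/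
def initial {n : ℕ} (a : Fin n → S) : ℕ → S
  | 0 => 1
  | k + 1 => if h : k < n then a ⟨k, h⟩ else 0

theorem map_initial {n : ℕ} (φ : S →+* T) (a : Fin n → S) (k : ℕ) :
    φ (initial a k) = initial (fun i => φ (a i)) k := by
  cases k with
  | zero => simp [initial]
  | succ k => by_cases h : k < n <;> simp [initial, h]

/-- `SpanReach t U` says that `U` is spanned by `1`, the variables and `t` further polynomials,
each the product of two elements of the span of the previous ones. -/
inductive SpanReach {V R : Type*} [CommSemiring R] : ℕ → Submodule R (MvPolynomial V R) → Prop
  | zero : SpanReach 0 (Submodule.span R (insert 1 (Set.range MvPolynomial.X)))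
  | succ {t U p q} : SpanReach t U → p ∈ U → q ∈ U → SpanReach (t + 1) (U ⊔ Submodule.span R {p * q})

section

variable {V R : Type*} [CommSemiring R] {t t' : ℕ} {U : Submodule R (MvPolynomial V R)}

theorem SpanReach.of_le (h : SpanReach t U) (ht : t ≤ t') : SpanReach t' U := by
  induction ht with
  | refl => exact h
  | step _ ih => simpa using ih.succ U.zero_mem U.zero_mem

theorem SpanReach.initial_le (h : SpanReach t U) :
    Submodule.span R (insert 1 (Set.range MvPolynomial.X)) ≤ U := by
  induction h with
  | zero => exact le_rfl
  | succ _ _ _ ih => exact ih.trans le_sup_left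

/-- Multiplying the factors one at a time onto `1` takes one new product per factor, hence one per
wire of the gate. -/
theorem SpanReach.prod (h : SpanReach t U) (l : List (MvPolynomial V R)) (hl : ∀ p ∈ l, p ∈ U) :
    ∃ U', U ≤ U' ∧ SpanReach (t + l.length) U' ∧ l.prod ∈ U' := by
  induction l with
  | nil => exact ⟨U, le_rfl, h, h.initial_le (Submodule.subset_span (Or.inl rfl))⟩
  | cons p l ih =>
    obtain ⟨U', h1, h2, h3⟩ := ih fun q hq => hl q (List.mem_cons_of_mem p hq)
    refine ⟨_, h1.trans le_sup_left, h2.succ (h1 (hl p List.mem_cons_self)) h3, ?_⟩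
    rw [List.prod_cons]
    exact Submodule.mem_sup_right (Submodule.mem_span_singleton_self _)

/-- Constants and sums stay in the span, so only product gates enlarge it. The number of steps is
therefore bounded by wires, whatever the number of nodes. -/
theorem Circuit.ProjectionFree.exists_spanReach {Γ : Circuit R V} (hΓ : Γ.ProjectionFree) {k : ℕ}
    (hk : k ≤ Γ.length) :
    ∃ U, SpanReach (∑ i : Fin k, (Γ.gate (i.castLE hk)).wires) U ∧
      ∀ i : Fin k, Γ.value (i.castLE hk) ∈ U := by
  induction k with
  | zero => exact ⟨_, .zero, fun i => i.elim0⟩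
  | succ k ih =>
    obtain ⟨U, h1, h2⟩ := ih (Nat.le_of_succ_le hk)
    suffices ∃ U', U ≤ U' ∧ SpanReach ((∑ i : Fin k, (Γ.gate (i.castLE
        (Nat.le_of_succ_le hk))).wires) + (Γ.gate ⟨k, hk⟩).wires) U' ∧ Γ.value ⟨k, hk⟩ ∈ U' by
      obtain ⟨U', h3, h4, h5⟩ := this
      refine ⟨U', ?_, ?_⟩
      · rw [Fin.sum_univ_castSucc]
        exact h4
      · refine Fin.lastCases h5 fun i => h3 (h2 i)
    have hlist : ∀ l : List (Fin k), ∀ p ∈ l.map fun j : Fin k =>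
        Γ.value ⟨j, j.2.trans hk⟩, p ∈ U := by
      intro l p hp
      obtain ⟨j, -, rfl⟩ := List.mem_map.1 hp
      exact h2 j
    rw [Γ.value_eq]
    generalize hg : Γ.gate ⟨k, hk⟩ = g
    cases g with
    | const a =>
      refine ⟨U, le_rfl, h1, h1.initial_le ?_⟩
      have : Gate.apply (Gate.const a : Gate R V k)
          (fun j : Fin k => Γ.value ⟨j, j.2.trans hk⟩) = a • (1 : MvPolynomial V R) := by
        simp [Gate.apply, MvPolynomial.smul_eq_C_mul]
      rw [this]
      exact Submodule.smul_mem _ _ (Submodule.subset_span (Or.inl rfl))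
    | var x =>
      exact ⟨U, le_rfl, h1, h1.initial_le (Submodule.subset_span (Or.inr ⟨x, rfl⟩))⟩
    | sum c cs =>
      exact ⟨U, le_rfl, h1.of_le (Nat.le_add_right _ _),
        list_sum_mem (hlist (c :: cs))⟩
    | prod c cs =>
      obtain ⟨U', h3, h4, h5⟩ := h1.prod _ (hlist (c :: cs))
      exact ⟨U', h3, by simpa [Gate.wires] using h4, h5⟩
    | proj w b c => exact absurd hg (hΓ _ w b c)

theorem ComputableInSize.exists_spanReach {f : MvPolynomial V R} {s : ℕ}
    (h : ComputableInSize f s) : ∃ U, SpanReach s U ∧ f ∈ U := by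
  obtain ⟨Γ, h1, h2, rfl⟩ := h
  obtain ⟨U, h3, h4⟩ := h1.exists_spanReach le_rfl
  exact ⟨U, h3.of_le h2, h4 Γ.output⟩

end

theorem exists_coeff_of_mem_span_image {M : Type*} [AddCommGroup M] [Module S M] (v : ℕ → M)
    (m : ℕ) {p : M} (hp : p ∈ Submodule.span S (v '' Set.Iio m)) :
    ∃ a : ℕ → S, p = ∑ j ∈ range m, a j • v j := by
  rw [← Finset.coe_range m, Submodule.mem_span_image_finset_iff_exists_fun']
    at hp
  obtain ⟨a, ha⟩ := hp
  exact ⟨a, ha.symm⟩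

theorem SpanReach.exists_slp {n t : ℕ} {U : Submodule S (MvPolynomial (Fin n) S)}
    (h : SpanReach t U) :
    ∃ α β : ℕ → ℕ → S, U ≤ Submodule.span S
      (slp (n + 1) (initial MvPolynomial.X) (fun k j => MvPolynomial.C (α k j))
        (fun k j => MvPolynomial.C (β k j)) '' Set.Iio (n + 1 + t)) := by
  induction h with
  | zero =>
    refine ⟨0, 0, Submodule.span_mono ?_⟩
    rintro p (rfl | ⟨x, rfl⟩)
    · exact ⟨0, by simp, by rw [slp_of_lt _ _ _ (Nat.succ_pos n)]; rfl⟩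
    · refine ⟨x + 1, by simp, ?_⟩
      rw [slp_of_lt _ _ _ (Nat.succ_lt_succ x.2)]
      simp [initial]
  | @succ t U p q _ hp hq ih =>
    obtain ⟨α, β, hU⟩ := ih
    obtain ⟨a, ha⟩ := exists_coeff_of_mem_span_image _ _ (hU hp)
    obtain ⟨b, hb⟩ := exists_coeff_of_mem_span_image _ _ (hU hq)
    -- The new coefficients occupy a row that earlier values do not read.
    refine ⟨Function.update α (n + 1 + t) a, Function.update β (n + 1 + t) b, ?_⟩
    have key : ∀ m < n + 1 + t,
        slp (n + 1) (initial (MvPolynomial.X : Fin n → MvPolynomial (Fin n) S))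
          (fun k j => MvPolynomial.C (Function.update α (n + 1 + t) a k j))
          (fun k j => MvPolynomial.C (Function.update β (n + 1 + t) b k j)) m =
        slp (n + 1) (initial MvPolynomial.X) (fun k j => MvPolynomial.C (α k j))
          (fun k j => MvPolynomial.C (β k j)) m := by
      intro m hm
      refine slp_congr (fun _ _ => rfl) (fun k hk j _ => ?_) fun k hk j _ => ?_ <;>
        rw [Function.update_of_ne (by omega)]
    refine sup_le (hU.trans (Submodule.span_le.2 ?_)) (Submodule.span_le.2 ?_)
    · rintro _ ⟨m, hm, rfl⟩
      rw [← key m hm]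
      exact Submodule.subset_span ⟨m, Nat.lt_succ_of_lt hm, rfl⟩
    · rintro _ rfl
      refine Submodule.subset_span ⟨n + 1 + t, Nat.lt_succ_self _, ?_⟩
      rw [slp_of_le _ _ _ (Nat.le_add_right _ _), ha, hb]
      congr 1 <;>
      · refine sum_congr rfl fun j hj => ?_
        rw [key j (mem_range.1 hj), Function.update_self, MvPolynomial.smul_eq_C_mul]

/-- The universal program computes every polynomial that has a circuit of size `s`. -/
theorem ComputableInSize.exists_slp {n s : ℕ} {f : MvPolynomial (Fin n) S}
    (h : ComputableInSize f s) :
    ∃ α β : ℕ → ℕ → S, ∀ a : Fin n → S,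
      MvPolynomial.eval a f = slp (n + 1) (initial a) α β (n + 1 + s) := by
  obtain ⟨U, h1, h2⟩ := h.exists_spanReach
  obtain ⟨α, β, hU⟩ := h1.exists_slp
  obtain ⟨a, ha⟩ := exists_coeff_of_mem_span_image _ _ (hU h2)
  -- `f` is only in the span of the values. One extra step computes the linear combination and
  -- multiplies it by the initial value `1`, selected by `Pi.single 0 1`.
  refine ⟨Function.update α (n + 1 + s) a, Function.update β (n + 1 + s) (Pi.single 0 1),
    fun x => ?_⟩
  rw [slp_of_le _ _ _ (Nat.le_add_right _ _), ha, map_sum]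
  have h1 : ∀ j < n + 1 + s, slp (n + 1) (initial x) (Function.update α (n + 1 + s) a)
      (Function.update β (n + 1 + s) (Pi.single 0 1)) j = slp (n + 1) (initial x) α β j := by
    intro j hj
    refine slp_congr (fun _ _ => rfl) (fun k hk j _ => ?_) fun k hk j _ => ?_ <;>
      rw [Function.update_of_ne (by omega)]
  have h2 : ∑ j ∈ range (n + 1 + s), Function.update β (n + 1 + s) (Pi.single 0 1) (n + 1 + s) j *
      slp (n + 1) (initial x) (Function.update α (n + 1 + s) a)
      (Function.update β (n + 1 + s) (Pi.single 0 1)) j = 1 := by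
    rw [sum_eq_single_of_mem 0 (mem_range.2 (by omega))]
    · rw [slp_of_lt _ _ _ (Nat.succ_pos n)]
      simp [initial]
    · intro j _ hj
      simp [Pi.single_eq_of_ne hj]
  rw [h2, mul_one]
  refine sum_congr rfl fun j hj => ?_
  rw [h1 j (mem_range.1 hj), MvPolynomial.smul_eval, map_slp, Function.update_self]
  congr 1
  refine slp_congr (fun k _ => ?_) (fun k _ j _ => ?_) fun k _ j _ => ?_
  · rw [map_initial]; simp
  · simp
  · simp

end Universal

/-! ### Boolean sums by projection gates -/

section BooleanSums

variable {V : Type*} {F : Set (PolyFun V)} {f : PolyFun V} {t : ℕ}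

theorem extend_option {ι : Type*} {u : Option ι → V} (hu : Function.Injective u) [DecidableEq V]
    (z : Option ι → ℤ) (τ : V → ℤ) :
    Function.update (Function.extend (u ∘ some) (z ∘ some) τ) (u none) (z none) =
      Function.extend u z τ := by
  funext v
  by_cases hv : ∃ i, u i = v
  · obtain ⟨i, rfl⟩ := hv
    rw [hu.extend_apply]
    cases i with
    | none => rw [Function.update_self]
    | some i =>
      rw [Function.update_of_ne (by simpa using hu.ne (Option.some_ne_none i))]
      exact (hu.comp (Option.some_injective ι)).extend_apply _ _ i
  · rw [Function.extend_apply' _ _ _ hv, Function.update_of_ne fun h => hv ⟨none, h.symm⟩,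
      Function.extend_apply' (f := u ∘ some) _ _ _ fun ⟨i, hi⟩ => hv ⟨some i, hi⟩]

theorem extend_comp_equiv {α β : Type*} {u : β → V} (hu : Function.Injective u) (e : α ≃ β)
    (z : β → ℤ) (τ : V → ℤ) :
    Function.extend (u ∘ e) (z ∘ e) τ = Function.extend u z τ := by
  funext v
  by_cases hv : ∃ i, u i = v
  · obtain ⟨i, rfl⟩ := hv
    rw [hu.extend_apply]
    obtain ⟨j, rfl⟩ := e.surjective i
    exact (hu.comp e.injective).extend_apply _ _ j
  · rw [Function.extend_apply' _ _ _ hv,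
      Function.extend_apply' (f := u ∘ e) _ _ _ fun ⟨i, hi⟩ => hv ⟨e i, hi⟩]

/-- The values `0` and `1` of a Boolean vector. -/
def bits {ι : Type*} (x : ι → Bool) (i : ι) : ℤ := ((x i).toNat : ℤ)

theorem Cost.set_bits {ι : Type*} [Fintype ι] {u : ι → V} (hu : Function.Injective u)
    (x : ι → Bool) (h : Cost F t f) :
    Cost F (t + Fintype.card ι) (fun τ => f (Function.extend u (bits x) τ)) := by
  classical
  have key : ∀ (ι : Type _) [Fintype ι], ∀ (u : ι → V) (x : ι → Bool) (f : PolyFun V) (t : ℕ),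
      Function.Injective u → Cost F t f →
      Cost F (t + Fintype.card ι) (fun τ => f (Function.extend u (bits x) τ)) := by
    intro ι _
    refine Fintype.induction_empty_option (P := fun ι _ => ∀ (u : ι → V) (x : ι → Bool)
      (f : PolyFun V) (t : ℕ), Function.Injective u → Cost F t f →
      Cost F (t + Fintype.card ι) (fun τ => f (Function.extend u (bits x) τ))) ?_ ?_ ?_ ι
    · intro α β _ e ih u x f t hu h
      let _ := Fintype.ofEquiv β e.symm
      have := ih (u ∘ e) (x ∘ e) f t (hu.comp e.injective) h
      rw [Fintype.card_congr e] at this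
      convert this using 3
      exact (extend_comp_equiv hu e (bits x) _).symm
    · intro u x f t hu h
      convert h.mono (Nat.le_add_right t _) using 3
      exact funext fun v => Function.extend_apply' _ _ _ fun ⟨i, _⟩ => i.elim
    · intro ι _ ih u x f t hu h
      have := ih (u ∘ some) (x ∘ some) _ _ (hu.comp (Option.some_injective ι))
        (h.set (u none) (x none))
      rw [Fintype.card_option]
      convert this.mono (t' := t + (Fintype.card ι + 1)) (by omega) using 3
      rw [← extend_option hu]
      rfl
  exact key ι u x f t hu h

theorem sum_option_bool {ι : Type*} [Fintype (Option ι → Bool)] [Fintype (ι → Bool)]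
    (f : (Option ι → Bool) → ℤ) :
    ∑ x, f x = ∑ x : ι → Bool, (f (fun i => i.elim false x) + f (fun i => i.elim true x)) := by
  rw [Fintype.sum_equiv (Equiv.piOptionEquivProd (β := fun _ : Option ι => Bool)) f
    (fun y => f (fun i => i.elim y.1 y.2))]
  · rw [Fintype.sum_prod_type_right]
    exact Finset.sum_congr rfl fun x _ => by rw [Fintype.sum_bool, add_comm]
  · intro x
    congr 1
    funext i
    cases i <;> rfl

/-- Each variable costs four wires: two projections of the same node and a binary sum. Since the
node is shared, the cost grows linearly in the number of variables although the sum has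
exponentially many terms. -/
theorem Cost.sum_bits {ι : Type*} [Fintype ι] [inst : Fintype (ι → Bool)] {u : ι → V}
    (hu : Function.Injective u) (h : Cost F t f) :
    Cost F (t + Fintype.card ι * 4)
      (fun τ => ∑ x : ι → Bool, f (Function.extend u (bits x) τ)) := by
  have key : ∀ (ι : Type _) [Fintype ι], ∀ (_ : Fintype (ι → Bool)) (u : ι → V) (f : PolyFun V)
      (t : ℕ), Function.Injective u → Cost F t f →
      Cost F (t + Fintype.card ι * 4)
        (fun τ => ∑ x : ι → Bool, f (Function.extend u (bits x) τ)) := by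
    intro ι _
    refine Fintype.induction_empty_option (P := fun ι _ => ∀ (_ : Fintype (ι → Bool)) (u : ι → V)
      (f : PolyFun V) (t : ℕ), Function.Injective u → Cost F t f →
      Cost F (t + Fintype.card ι * 4)
        (fun τ => ∑ x : ι → Bool, f (Function.extend u (bits x) τ))) ?_ ?_ ?_ ι
    · intro α β _ e ih _ u f t hu h
      let _ := Fintype.ofEquiv β e.symm
      let _ : Fintype (α → Bool) := Fintype.ofEquiv _ (e.symm.arrowCongr (Equiv.refl Bool))
      have := ih inferInstance (u ∘ e) f t
        (hu.comp e.injective) h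
      rw [Fintype.card_congr e] at this
      convert this using 2
      refine Fintype.sum_equiv (e.symm.arrowCongr (Equiv.refl Bool)) _ _ fun x => ?_
      rw [← extend_comp_equiv hu e]
      rfl
    · intro _ u f t hu h
      convert h.mono (Nat.le_add_right t _) using 2 with τ
      rw [Fintype.sum_unique]
      congr 1
      exact funext fun v => Function.extend_apply' _ _ _ fun ⟨i, _⟩ => i.elim
    · intro ι _ ih _ u f t hu h
      classical
      have h2 := (Builds.cut h ((Cost.set (u none) false (Cost.of_mem (Or.inr rfl))).add
        (Cost.set (u none) true (Cost.of_mem (Or.inr rfl))))).cost (Or.inr rfl)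
      have := ih inferInstance (u ∘ some) _ _ (hu.comp (Option.some_injective ι)) h2
      rw [Fintype.card_option]
      convert this.mono (t' := t + (Fintype.card ι + 1) * 4) (by omega) using 2 with τ
      rw [sum_option_bool]
      refine Finset.sum_congr rfl fun x _ => ?_
      rw [← extend_option hu, ← extend_option hu]
      rfl
  exact key ι inst u f t hu h

end BooleanSums

/-! ### Products of exponentially many matrices -/

section IteratedProduct

open Finset

variable {σ ι : Type*}

/-- The variables of the circuits below: the given ones, three blocks of state bits and the time
bits. -/
abbrev IterVar (σ ι : Type*) : Type _ := σ ⊕ (Fin 3 × ι ⊕ ℕ)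

/-- The variable for the bit `i` of the state in block `a`. -/
def stateVar (a : Fin 3) (i : ι) : IterVar σ ι := Sum.inr (Sum.inl (a, i))

/-- The variable for the bit `l` of the time. -/
def timeVar (l : ℕ) : IterVar σ ι := Sum.inr (Sum.inr l)

theorem stateVar_injective (a : Fin 3) :
    Function.Injective (stateVar a : ι → IterVar σ ι) := by
  intro i j h
  simpa [stateVar] using h

/-- The function `f` represents the matrix `M s` between states in the blocks `a` and `b`, for
times `s` given by their bits from `q` to `L - 1`. -/
def Represents (q L : ℕ) (a b : Fin 3) (M : ℕ → Matrix (ι → Bool) (ι → Bool) ℤ)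
    (f : PolyFun (IterVar σ ι)) : Prop :=
  ∀ (τ : IterVar σ ι → ℤ) (x y : ι → Bool) (c : ℕ → Bool),
    (∀ i, τ (stateVar a i) = bits x i) → (∀ i, τ (stateVar b i) = bits y i) →
    (∀ l ∈ Ico q L, τ (timeVar l) = bits c l) →
    f τ = M (∑ l ∈ Ico q L, (c l).toNat * 2 ^ l) x y

variable [Fintype ι] [DecidableEq ι]

/-- The product of `T s, …, T (s + 2 ^ q - 1)`, later factors to the left. -/
def timeProd (T : ℕ → Matrix (ι → Bool) (ι → Bool) ℤ) :
    ℕ → ℕ → Matrix (ι → Bool) (ι → Bool) ℤ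
  | 0, s => T s
  | q + 1, s => timeProd T q (s + 2 ^ q) * timeProd T q s

theorem timeProd_mulVec {T : ℕ → Matrix (ι → Bool) (ι → Bool) ℤ} {N : ℕ → (ι → Bool) → ℤ}
    (hN : ∀ s, N (s + 1) = (T s).mulVec (N s)) (q s : ℕ) :
    (timeProd T q s).mulVec (N s) = N (s + 2 ^ q) := by
  induction q generalizing s with
  | zero => exact (hN s).symm
  | succ q ih => rw [timeProd, ← Matrix.mulVec_mulVec, ih, ih, add_assoc, ← two_mul, ← pow_succ']

/-- Block `c` holds the midpoint of the path and is summed out. Setting bit `q` of the time to `1`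
or `0` selects the later or the earlier half, so both halves come from families indexed by the
remaining bits. -/
theorem Represents.step {q L : ℕ} (hq : q < L) {a b c : Fin 3} (hac : a ≠ c) (hbc : b ≠ c)
    {T : ℕ → Matrix (ι → Bool) (ι → Bool) ℤ} {f g : PolyFun (IterVar σ ι)}
    (hf : Represents q L a c (timeProd T q) f) (hg : Represents q L c b (timeProd T q) g) :
    Represents (q + 1) L a b (timeProd T (q + 1)) (fun τ => ∑ z : ι → Bool,
      (f.set (timeVar q) true * g.set (timeVar q) false)
        (Function.extend (stateVar c) (bits z) τ)) := by
  classical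
  intro τ x y d hx hy hd
  rw [timeProd, Matrix.mul_apply]
  refine sum_congr rfl fun z _ => ?_
  have hstate : ∀ (b' : Bool) (e : Fin 3) (w : ι → Bool), (∀ i, Function.extend (stateVar c)
      (bits z) τ (stateVar e i) = bits w i) → ∀ i, Function.update (Function.extend (stateVar c)
      (bits z) τ) (timeVar q) (b'.toNat : ℤ) (stateVar e i) = bits w i := by
    intro b' e w h i
    rw [Function.update_of_ne (by simp [stateVar, timeVar]), h]
  have hc : ∀ i, Function.extend (stateVar c) (bits z) τ (stateVar c i) = bits z i :=
    fun i => (stateVar_injective c).extend_apply _ _ i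
  have hother : ∀ e w, e ≠ c → (∀ i, τ (stateVar e i) = bits w i) → ∀ i,
      Function.extend (stateVar c) (bits z) τ (stateVar e i) = bits w i := by
    intro e w he hw i
    rw [Function.extend_apply', hw]
    rintro ⟨j, hj⟩
    simp only [stateVar, Sum.inr.injEq, Sum.inl.injEq, Prod.mk.injEq] at hj
    exact he hj.1.symm
  have htime : ∀ b' : Bool, ∀ l ∈ Ico q L, Function.update (Function.extend (stateVar c)
      (bits z) τ) (timeVar q) (b'.toNat : ℤ) (timeVar l) = bits (Function.update d q b') l := by
    intro b' l hl
    by_cases h : l = q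
    · subst h; simp [bits]
    · rw [Function.update_of_ne (by simpa [timeVar] using h), Function.extend_apply', hd]
      · simp [bits, h]
      · rw [mem_Ico] at hl ⊢; omega
      · rintro ⟨j, hj⟩
        simp [stateVar, timeVar] at hj
  have hsum : ∀ b' : Bool, ∑ l ∈ Ico q L, (Function.update d q b' l).toNat * 2 ^ l =
      (∑ l ∈ Ico (q + 1) L, (d l).toNat * 2 ^ l) + b'.toNat * 2 ^ q := by
    intro b'
    rw [sum_eq_sum_Ico_succ_bot hq, Function.update_self, add_comm]
    congr 1
    refine sum_congr rfl fun l hl => ?_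
    rw [Function.update_of_ne (by rw [mem_Ico] at hl; omega)]
  have h1 := hf _ x z _ (hstate true a x (hother a x hac hx)) (hstate true c z hc) (htime true)
  have h2 := hg _ z y _ (hstate false c z hc) (hstate false b y (hother b y hbc hy)) (htime false)
  rw [hsum] at h1 h2
  simp only [Bool.toNat_true, Bool.toNat_false, one_mul, zero_mul, add_zero] at h1 h2
  rw [← h1, ← h2]
  simp only [Pi.mul_apply, PolyFun.set]
  congr!

/-- A product of `2 ^ L` matrices of exponential size has a small circuit with projection gates. -/
theorem exists_cost_timeProd {F : Set (PolyFun (IterVar σ ι))}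
    (T : ℕ → Matrix (ι → Bool) (ι → Bool) ℤ) (L t : ℕ)
    (h : ∀ a b, a ≠ b → ∃ f, Cost F t f ∧ Represents 0 L a b T f) :
    ∃ f, Cost F (9 * t + L * (36 * (Fintype.card ι + 1))) f ∧
      Represents L L 0 1 (timeProd T L) f := by
  -- All ordered pairs of blocks are kept at each level. Three blocks suffice because a midpoint can
  -- reuse the block not used by the endpoints; so each level adds nine functions instead of
  -- doubling the circuit. Diagonal pairs are placeholders.
  have key : ∀ q ≤ L, ∃ p : Fin 3 → Fin 3 → PolyFun (IterVar σ ι),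
      Builds F (9 * t + q * (36 * (Fintype.card ι + 1))) (⋃ i ∈ (univ : Finset (Fin 3 × Fin 3)),
        {p i.1 i.2}) ∧
      ∀ a b, a ≠ b → Represents q L a b (timeProd T q) (p a b) := by
    intro q
    induction q with
    | zero =>
      intro _
      have : ∀ a b, ∃ f, Cost F t f ∧ (a ≠ b → Represents 0 L a b T f) := fun a b => by
        by_cases hab : a = b
        · exact ⟨1, Cost.one.mono t.zero_le, fun h => absurd hab h⟩
        · obtain ⟨f, h1, h2⟩ := h a b hab
          exact ⟨f, h1, fun _ => h2⟩
      choose p hp hp' using this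
      refine ⟨p, ?_, hp'⟩
      refine (Builds.iUnion univ (fun _ => t) (fun i : Fin 3 × Fin 3 => {p i.1 i.2})
        fun i _ => hp i.1 i.2).mono subset_rfl ?_ subset_rfl
      simp
    | succ q ih =>
      intro hq
      obtain ⟨p, h1, h2⟩ := ih (Nat.le_of_succ_le hq)
      -- For distinct `a` and `b` in `Fin 3`, `-(a + b)` is the third element.
      refine ⟨fun a b τ => ∑ z : ι → Bool, ((p a (-(a + b))).set (timeVar q) true *
        (p (-(a + b)) b).set (timeVar q) false)
          (Function.extend (stateVar (-(a + b))) (bits z) τ), ?_, ?_⟩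
      · have hmem : ∀ a b, Cost (F ∪ ⋃ i ∈ (univ : Finset (Fin 3 × Fin 3)), {p i.1 i.2}) 0
            (p a b) := by
          intro a b
          refine Cost.of_mem (Or.inr ?_)
          simp only [Set.mem_iUnion]
          exact ⟨(a, b), mem_univ _, rfl⟩
        refine (h1.cut (Builds.iUnion univ (fun _ => 4 * (Fintype.card ι + 1)) _ fun i _ =>
          Cost.mono ((((hmem i.1 (-(i.1 + i.2))).set (timeVar q) true).mul
            ((hmem (-(i.1 + i.2)) i.2).set (timeVar q) false)).sum_bits
              (stateVar_injective (-(i.1 + i.2)))) (by omega))).mono subset_rfl ?_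
          Set.subset_union_right
        simp only [sum_const, card_univ, Fintype.card_prod, Fintype.card_fin, smul_eq_mul]
        apply le_of_eq
        ring
      · intro a b hab
        have hne : ∀ a b : Fin 3, a ≠ b → a ≠ -(a + b) ∧ b ≠ -(a + b) := by decide
        obtain ⟨h3, h4⟩ := hne a b hab
        exact Represents.step hq h3 h4 (h2 _ _ h3) (h2 _ _ h4.symm)
  obtain ⟨p, h1, h2⟩ := key L le_rfl
  refine ⟨p 0 1, h1.cost ?_, h2 0 1 (by decide)⟩
  simp only [Set.mem_iUnion]
  exact ⟨(0, 1), mem_univ _, rfl⟩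

end IteratedProduct

/-! ### The iteration as a matrix product, and the kernel polynomial -/

section Transition

open Finset Matrix

variable {V σ κ : Type*}

/-- The function that reads one variable. -/
def coord (x : V) : PolyFun V := fun τ => τ x

theorem Cost.coord {F : Set (PolyFun V)} (x : V) : Cost F 0 (coord x) := Cost.var x

/-- The indicator function of the equality of two vectors of bits. -/
def eqFun [Fintype κ] (u v : κ → V) : PolyFun V :=
  ∏ k, (coord (u k) * coord (v k) + (1 - coord (u k)) * (1 - coord (v k)))

theorem Cost.eqFun [Fintype κ] {F : Set (PolyFun V)} (u v : κ → V) :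
    Cost F (Fintype.card κ * 15) (eqFun u v) := by
  refine (Cost.finset_prod (t := 14) univ _ fun k _ => ?_).mono (by simp)
  exact (((Cost.coord _).mul (Cost.coord _)).add ((Cost.one.sub (Cost.coord _)).mul
    (Cost.one.sub (Cost.coord _))))

theorem eqFun_apply [Fintype κ] [DecidableEq κ] {u v : κ → V} {τ : V → ℤ} {x y : κ → Bool}
    (hx : ∀ k, τ (u k) = bits x k) (hy : ∀ k, τ (v k) = bits y k) :
    eqFun u v τ = if x = y then 1 else 0 := by
  have h : ∀ k, (coord (u k) * coord (v k) + (1 - coord (u k)) * (1 - coord (v k))) τ =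
      if x k = y k then 1 else 0 := by
    intro k
    simp only [Pi.add_apply, Pi.mul_apply, Pi.sub_apply, Pi.one_apply, coord, hx, hy, bits]
    cases x k <;> cases y k <;> simp
  rw [eqFun, Finset.prod_apply]
  simp only [h]
  rw [Finset.prod_ite_zero]
  simp [funext_iff]

/-- A power of two. -/
theorem Cost.two_pow {F : Set (PolyFun V)} (l : ℕ) : Cost F (l * 3) (2 ^ l) := by
  have := Cost.finset_prod (F := F) (t := 2) (range l) (fun _ => 1 + 1) fun _ _ =>
    Cost.one.add Cost.one
  simpa [one_add_one_eq_two] using this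

/-- The number with the given bits. -/
def binary (L : ℕ) (w : ℕ → V) : PolyFun V := ∑ l ∈ range L, coord (w l) * 2 ^ l

theorem Cost.binary {F : Set (PolyFun V)} (L : ℕ) (w : ℕ → V) :
    Cost F (L * (L * 3 + 3) + 2) (binary L w) := by
  refine (Cost.finset_sum (t := L * 3 + 2) (range L) _ fun l hl => ?_).mono (by simp)
  refine ((Cost.coord (w l)).mul (Cost.two_pow l)).mono ?_
  have := mem_range.1 hl
  omega

theorem binary_apply {L : ℕ} {w : ℕ → V} {τ : V → ℤ} {c : ℕ → Bool}
    (h : ∀ l < L, τ (w l) = bits c l) :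
    binary L w τ = ((∑ l ∈ range L, (c l).toNat * 2 ^ l : ℕ) : ℤ) := by
  rw [binary, Finset.sum_apply]
  push_cast
  exact sum_congr rfl fun l hl => by simp [coord, h l (mem_range.1 hl), bits]

/-- The indicator function of the numbers, given by their bits, that are less than `r`. -/
def ltFun (r : ℕ) (w : ℕ → V) : ℕ → PolyFun V
  | 0 => 0
  | l + 1 => if r.testBit l then (1 - coord (w l)) + coord (w l) * ltFun r w l
      else (1 - coord (w l)) * ltFun r w l

theorem Cost.ltFun {F : Set (PolyFun V)} (r : ℕ) (w : ℕ → V) (l : ℕ) :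
    Cost F (l * 8 + 2) (ltFun r w l) := by
  induction l with
  | zero => exact Cost.zero.mono (by omega)
  | succ l ih =>
    rw [AlgebraicCircuit.ltFun]
    split
    · exact ((Cost.one.sub (Cost.coord _)).add ((Cost.coord _).mul ih)).mono (by omega)
    · exact ((Cost.one.sub (Cost.coord _)).mul ih).mono (by omega)

theorem sum_bits_lt (c : ℕ → Bool) (l : ℕ) : ∑ i ∈ range l, (c i).toNat * 2 ^ i < 2 ^ l := by
  induction l with
  | zero => simp
  | succ l ih =>
    rw [sum_range_succ, pow_succ]
    cases c l <;> simp <;> omega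

theorem mod_two_pow_succ (r l : ℕ) :
    r % 2 ^ (l + 1) = r % 2 ^ l + 2 ^ l * (r.testBit l).toNat := by
  rw [Nat.pow_succ, Nat.mod_mul, Nat.testBit_eq_decide_div_mod_eq]
  rcases Nat.mod_two_eq_zero_or_one (r / 2 ^ l) with h | h <;> simp [h]

theorem sum_testBit (r L : ℕ) : ∑ l ∈ range L, (r.testBit l).toNat * 2 ^ l = r % 2 ^ L := by
  induction L with
  | zero => simp [Nat.mod_one]
  | succ L ih => rw [sum_range_succ, ih, mod_two_pow_succ, mul_comm]

theorem ltFun_apply {r l : ℕ} {w : ℕ → V} {τ : V → ℤ} {c : ℕ → Bool}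
    (h : ∀ i < l, τ (w i) = bits c i) :
    ltFun r w l τ = if ∑ i ∈ range l, (c i).toNat * 2 ^ i < r % 2 ^ l then 1 else 0 := by
  induction l with
  | zero => simp [ltFun, Nat.mod_one]
  | succ l ih =>
    have ih := ih fun i hi => h i (Nat.lt_succ_of_lt hi)
    have h1 := sum_bits_lt c l
    have h2 : r % 2 ^ l < 2 ^ l := Nat.mod_lt _ (Nat.two_pow_pos l)
    have hl := h l (Nat.lt_succ_self l)
    rw [ltFun, mod_two_pow_succ, sum_range_succ]
    cases hr : r.testBit l <;> cases hc : c l <;>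
      simp only [coord, hl, ih, bits, hc, Pi.add_apply, Pi.sub_apply, Pi.one_apply, Pi.mul_apply,
        Bool.toNat_true, Bool.toNat_false, if_true, if_false, mul_zero, mul_one, zero_mul, one_mul,
        add_zero, Bool.false_eq_true, Nat.cast_zero, Nat.cast_one, sub_zero, sub_self, zero_add]
    · rw [if_neg (by omega)]
    · rw [if_pos (by omega)]
    · congr 1
      simp only [eq_iff_iff]
      omega

variable [Fintype κ] [DecidableEq κ]

/-- The matrix of the step number `s` of the Faddeev–LeVerrier iteration for `G`, acting on matrices
as vectors. From step `r` on, it is the identity. -/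
def transition (G : Matrix (κ → Bool) (κ → Bool) ℤ) (r s : ℕ) :
    Matrix (κ ⊕ κ → Bool) (κ ⊕ κ → Bool) ℤ := fun x y =>
  if s < r then
    (s : ℤ) * G (x ∘ Sum.inl) (y ∘ Sum.inl) * (if x ∘ Sum.inr = y ∘ Sum.inr then 1 else 0) -
      (if x ∘ Sum.inl = x ∘ Sum.inr then 1 else 0) * G (y ∘ Sum.inr) (y ∘ Sum.inl)
  else if x = y then 1 else 0

theorem sum_sum_arrow (f : (κ ⊕ κ → Bool) → ℤ) :
    ∑ x, f x = ∑ x : κ → Bool, ∑ y : κ → Bool, f (Sum.elim x y) := by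
  rw [← Fintype.sum_prod_type']
  refine Fintype.sum_equiv (Equiv.sumArrowEquivProdArrow κ κ Bool) _ _ fun x => ?_
  exact congrArg f (Sum.elim_comp_inl_inr x).symm

/-- Each step is linear in the current matrix, its trace term included. Freezing the iteration at
`r` allows the number of factors to be rounded up to a power of two. -/
theorem transition_mulVec (G S : Matrix (κ → Bool) (κ → Bool) ℤ) (r s : ℕ) :
    (fun x : κ ⊕ κ → Bool => faddeevLeVerrier G S (min (s + 1) r) (x ∘ Sum.inl) (x ∘ Sum.inr)) =
      (transition G r s).mulVec fun x =>
        faddeevLeVerrier G S (min s r) (x ∘ Sum.inl) (x ∘ Sum.inr) := by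
  funext x
  by_cases h : s < r
  · rw [min_eq_left h.le, min_eq_left (Nat.succ_le_of_lt h), faddeevLeVerrier, mulVec, dotProduct,
      sum_sum_arrow]
    simp only [transition, if_pos h, Sum.elim_comp_inl, Sum.elim_comp_inr, sub_mul, sum_sub_distrib,
      Matrix.sub_apply, Matrix.smul_apply, smul_eq_mul]
    congr 1
    · rw [Matrix.mul_apply, mul_sum]
      refine sum_congr rfl fun a _ => ?_
      rw [sum_eq_single (x ∘ Sum.inr)]
      · simp [mul_assoc]
      · intro b _ hb
        simp [hb.symm]
      · simp
    · rw [sum_comm, trace, sum_mul]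
      refine sum_congr rfl fun a _ => ?_
      rw [Matrix.diag_apply, Matrix.mul_apply, sum_mul]
      refine sum_congr rfl fun b _ => ?_
      rw [Matrix.one_apply]
      ring
  · have h' := not_lt.1 h
    have : transition G r s = 1 := by
      ext a b
      simp [transition, h, Matrix.one_apply]
    rw [this, one_mulVec, min_eq_right h', min_eq_right (h'.trans (Nat.le_succ s))]

theorem exists_cost_transition {F : Set (PolyFun (IterVar σ (κ ⊕ κ)))}
    (G : Matrix (κ → Bool) (κ → Bool) ℤ) {tG : ℕ}
    (hG : ∀ y e : κ → IterVar σ (κ ⊕ κ), ∃ f, Cost F tG f ∧ ∀ τ y' e',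
      (∀ k, τ (y k) = bits y' k) → (∀ k, τ (e k) = bits e' k) → f τ = G y' e')
    {r L : ℕ} (hr : r < 2 ^ L) (a b : Fin 3) :
    ∃ f, Cost F (2 * tG + (3 * L ^ 2 + 19 * L + 60 * Fintype.card κ + 26)) f ∧
      Represents 0 L a b (transition G r) f := by
  obtain ⟨g, hg, hg'⟩ := hG (fun k => stateVar a (.inl k)) (fun k => stateVar b (.inl k))
  obtain ⟨g₂, hg₂, hg₂'⟩ := hG (fun k => stateVar b (.inr k)) (fun k => stateVar b (.inl k))
  refine ⟨ltFun r timeVar L * (binary L timeVar * g *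
      eqFun (fun k : κ => stateVar a (.inr k)) (fun k => stateVar b (.inr k)) -
      eqFun (fun k : κ => stateVar a (.inl k)) (fun k => stateVar a (.inr k)) * g₂) +
      (1 - ltFun r timeVar L) * eqFun (stateVar a) (stateVar b), ?_, ?_⟩
  · refine (((Cost.ltFun r timeVar L).mul
      ((((Cost.binary L timeVar).mul hg).mul (Cost.eqFun _ _)).sub
        ((Cost.eqFun _ _).mul hg₂))).add
      ((Cost.one.sub (Cost.ltFun r timeVar L)).mul (Cost.eqFun _ _))).mono ?_
    rw [Fintype.card_sum]
    apply le_of_eq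
    ring
  · intro τ x y c hx hy hc
    rw [← range_eq_Ico] at hc ⊢
    have hc' : ∀ l < L, τ (timeVar l) = bits c l := fun l hl => hc l (mem_range.2 hl)
    simp only [Pi.add_apply, Pi.mul_apply, Pi.sub_apply, Pi.one_apply]
    rw [ltFun_apply hc', binary_apply hc',
      hg' τ (x ∘ Sum.inl) (y ∘ Sum.inl) (fun k => hx (.inl k)) (fun k => hy (.inl k)),
      hg₂' τ (y ∘ Sum.inr) (y ∘ Sum.inl) (fun k => hy (.inr k)) (fun k => hy (.inl k)),
      eqFun_apply (x := x ∘ Sum.inr) (y := y ∘ Sum.inr) (fun k => hx (.inr k))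
        (fun k => hy (.inr k)),
      eqFun_apply (x := x ∘ Sum.inl) (y := x ∘ Sum.inr) (fun k => hx (.inl k))
        (fun k => hx (.inr k)),
      eqFun_apply hx hy, Nat.mod_eq_of_lt hr, transition]
    split <;> simp

/-- A singular matrix of exponential size, with entries given by a circuit, has a nonzero kernel
vector such that the multilinear polynomial with these coefficients has a small circuit with
projection gates. -/
theorem exists_kernel_cost (G : Matrix (κ → Bool) (κ → Bool) ℤ) (hdet : G.det = 0)
    (h0 : G (fun _ => false) (fun _ => false) ≠ 0) {tG : ℕ} (z : κ → σ)
    (hG : ∀ y e : κ → IterVar σ (κ ⊕ κ), ∃ f, Cost ∅ tG f ∧ ∀ τ y' e',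
      (∀ k, τ (y k) = bits y' k) → (∀ k, τ (e k) = bits e' k) → f τ = G y' e') :
    ∃ v : (κ → Bool) → ℤ, v ≠ 0 ∧ G *ᵥ v = 0 ∧
      Cost ∅ (18 * tG + 1200 * (Fintype.card κ + 1) ^ 2) (fun τ : IterVar σ (κ ⊕ κ) → ℤ =>
        ∑ e, v e * ∏ k, if e k then τ (Sum.inl (z k)) else 1) := by
  -- With this matrix unit, `trace (G * S)` is the entry assumed nonzero in `h0`, and applying the
  -- product of transitions to `S` reads off a single column.
  set S : Matrix (κ → Bool) (κ → Bool) ℤ :=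
    Matrix.single (fun _ => false) (fun _ => false) 1 with hS
  obtain ⟨r, hr, hr0, hGr⟩ := exists_mul_faddeevLeVerrier_eq_zero G S hdet
    (by rw [hS, Matrix.trace_mul_single]; simpa using h0)
  obtain ⟨e₀, he₀⟩ : ∃ e₀, (fun e => faddeevLeVerrier G S r e e₀) ≠ 0 := by
    by_contra! h
    exact hr0 (by ext a b; exact congrFun (h b) a)
  set v : (κ → Bool) → ℤ := fun e => faddeevLeVerrier G S r e e₀ with hv
  refine ⟨v, he₀, funext fun y => congrFun (congrFun hGr y) e₀, ?_⟩
  set L := Fintype.card κ + 1 with hL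
  have hrL : r < 2 ^ L := by
    rw [Fintype.card_fun, Fintype.card_bool] at hr
    exact hr.trans_lt (Nat.pow_lt_pow_right one_lt_two (Nat.lt_succ_self _))
  obtain ⟨p, hp, hp'⟩ := exists_cost_timeProd (transition G r) L _ fun a b _ =>
    exists_cost_transition G hG hrL a b
  have hpv : ∀ e : κ → Bool, timeProd (transition G r) L 0 (Sum.elim e e₀) (fun _ => false) =
      v e := by
    intro e
    have h := timeProd_mulVec (N := fun s x =>
      faddeevLeVerrier G S (min s r) (x ∘ Sum.inl) (x ∘ Sum.inr)) (transition_mulVec G S r) L 0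
    simp only [Nat.zero_min, zero_add, min_eq_right hrL.le, faddeevLeVerrier] at h
    have h := congrFun h (Sum.elim e e₀)
    rw [Sum.elim_comp_inl, Sum.elim_comp_inr, mulVec, dotProduct,
      sum_eq_single (fun _ => false)] at h
    · refine Eq.trans ?_ h
      simp [hS, Function.comp_def]
    · intro x _ hx
      rw [hS, Matrix.single_apply_of_ne, mul_zero]
      rintro ⟨h1, h2⟩
      refine hx (funext fun i => ?_)
      cases i with
      | inl k => exact (congrFun h1 k).symm
      | inr k => exact (congrFun h2 k).symm
    · simp
  have hinj : ∀ h : κ → κ ⊕ κ, Function.Injective h →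
      Function.Injective (fun k => stateVar 0 (h k) : κ → IterVar σ (κ ⊕ κ)) :=
    fun h hh => (stateVar_injective 0).comp hh
  have hmono : ∀ k : κ, Cost (∅ : Set (PolyFun (IterVar σ (κ ⊕ κ)))) 8
      (coord (stateVar 0 (.inl k)) * coord (Sum.inl (z k)) + (1 - coord (stateVar 0 (.inl k)))) :=
    fun k => ((Cost.coord _).mul (Cost.coord _)).add (Cost.one.sub (Cost.coord _))
  -- Fix the column state to the position of the unit in `S` and the column index of the result to
  -- `e₀`; then multiply by the monomial with exponent vector `e` and sum over `e`.
  have hcost := (((hp.set_bits (stateVar_injective 1) (fun _ => false)).set_bits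
    (hinj Sum.inr Sum.inr_injective) e₀).mul
      (Cost.finset_prod univ _ fun k _ => hmono k)).sum_bits (hinj Sum.inl Sum.inl_injective)
  convert hcost.mono ?_ using 2 with τ
  · refine sum_congr rfl fun e _ => ?_
    rw [Pi.mul_apply, Finset.prod_apply]
    have hne : ∀ (h : κ → κ ⊕ κ) (k : σ), ¬ ∃ j, (stateVar 0 (h j) : IterVar σ (κ ⊕ κ)) =
        Sum.inl k := fun h k ⟨j, hj⟩ => by simp [stateVar] at hj
    congr 1
    · rw [← hpv]
      symm
      refine (hp' _ (Sum.elim e e₀) (fun _ => false) (fun _ => false) ?_ ?_ ?_).trans ?_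
      · have hne1 : ∀ i, ¬ ∃ j : κ ⊕ κ, stateVar 1 j = (stateVar 0 i : IterVar σ (κ ⊕ κ)) :=
          fun i ⟨j, hj⟩ => by simp [stateVar] at hj
        intro i
        rw [Function.extend_apply' _ _ _ (hne1 i)]
        cases i with
        | inl k =>
          rw [Function.extend_apply' _ _ _ fun ⟨j, hj⟩ => by simp [stateVar] at hj]
          exact (hinj Sum.inl Sum.inl_injective).extend_apply _ _ k
        | inr k =>
          exact (hinj Sum.inr Sum.inr_injective).extend_apply _ _ k
      · exact fun i => (stateVar_injective 1).extend_apply _ _ i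
      · simp
      · simp
    · refine prod_congr rfl fun k _ => ?_
      simp only [Pi.add_apply, Pi.mul_apply, Pi.sub_apply, Pi.one_apply, coord]
      rw [Function.extend_apply' _ _ _ (hne Sum.inl (z k)),
        (hinj Sum.inl Sum.inl_injective).extend_apply _ _ k, bits]
      cases e k <;> simp
  · rw [Fintype.card_sum, card_univ]
    have : Fintype.card κ = L - 1 := rfl
    obtain ⟨m, hm⟩ : ∃ m, m = Fintype.card κ := ⟨_, rfl⟩
    rw [hL, ← hm]
    nlinarith [Nat.zero_le m, Nat.zero_le (m ^ 2)]

end Transition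

/-! ### The linear system for the equation -/

section Equation

open Finset Matrix

/-- All values are built together, so each step pays only for its own two linear combinations. -/
theorem Builds.slp {V : Type*} {F : Set (PolyFun V)} {N M cb cα : ℕ} {base : ℕ → PolyFun V}
    {α β : ℕ → ℕ → PolyFun V} (hb : ∀ k, Cost F cb (base k)) (hα : ∀ i j, Cost F cα (α i j))
    (hβ : ∀ i j, Cost F cα (β i j)) {m : ℕ} (hm : m ≤ M) :
    Builds F (m * (cb + M * (2 * cα + 6) + 6)) {g | ∃ j < m, g = slp N base α β j} := by
  induction m with
  | zero => exact .of_subset (by simp) _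
  | succ m ih =>
    set Q : Set (PolyFun V) := {g | ∃ j < m, g = AlgebraicCircuit.slp N base α β j} with hQ
    have hlin : ∀ γ : ℕ → ℕ → PolyFun V, (∀ i j, Cost F cα (γ i j)) →
        Cost (F ∪ Q) (m * (cα + 3) + 2) (∑ j ∈ range m, γ m j *
          AlgebraicCircuit.slp N base α β j) := by
      intro γ hγ
      refine (Cost.finset_sum (t := cα + 2) (range m) _ fun j hj => ?_).mono (by simp)
      exact ((hγ m j).weaken Set.subset_union_left).mul
        (Cost.of_mem (show _ ∈ F ∪ Q from Or.inr ⟨j, mem_range.1 hj, rfl⟩))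
    have hcost : Cost (F ∪ Q) (cb + M * (2 * cα + 6) + 6) (AlgebraicCircuit.slp N base α β m) := by
      by_cases h : m < N
      · rw [slp_of_lt _ _ _ h]
        exact ((hb m).weaken Set.subset_union_left).mono (by omega)
      · rw [slp_of_le _ _ _ (not_lt.1 h)]
        refine ((hlin α hα).mul (hlin β hβ)).mono ?_
        have : m * (2 * cα + 6) ≤ M * (2 * cα + 6) := Nat.mul_le_mul_right _ (by omega)
        have h2 : m * (2 * cα + 6) = m * (cα + 3) + m * (cα + 3) := by ring
        omega
    refine ((ih (by omega)).cut hcost).mono subset_rfl (Nat.succ_mul m _).ge ?_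
    rintro g ⟨j, hj, rfl⟩
    rcases Nat.lt_succ_iff_lt_or_eq.1 hj with h | rfl
    · exact Or.inl ⟨j, h, rfl⟩
    · exact Or.inr rfl

/-- The number of nodes of the universal program for `n` variables and size `s`. -/
abbrev progLength (n s : ℕ) : ℕ := n + s + 2

/-- The indices of the parameters of the universal program. -/
abbrev Param (n s : ℕ) : Type := Fin (progLength n s) × Fin (progLength n s) × Bool

section

variable {S T : Type*} [CommRing S] [CommRing T] {n s : ℕ}

/-- The coefficients of the linear combinations of one kind, from the parameters. -/
def paramCoeff (w : Param n s → S) (b : Bool) (i j : ℕ) : S :=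
  if h : i < progLength n s ∧ j < progLength n s then w (⟨i, h.1⟩, ⟨j, h.2⟩, b) else 0

/-- The value at the point `a` of the universal polynomial with the parameters `w`. -/
def universal (w : Param n s → S) (a : Fin n → S) : S :=
  slp (n + 1) (initial a) (paramCoeff w false) (paramCoeff w true) (n + 1 + s)

theorem map_universal (φ : S →+* T) (w : Param n s → S) (a : Fin n → S) :
    φ (universal w a) = universal (fun θ => φ (w θ)) (fun i => φ (a i)) := by
  rw [universal, map_slp, universal]
  refine slp_congr (fun k _ => map_initial φ a k) (fun i _ j _ => ?_) fun i _ j _ => ?_ <;>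
  · unfold paramCoeff
    split <;> simp

theorem ComputableInSize.exists_universal {f : MvPolynomial (Fin n) S}
    (h : ComputableInSize f s) :
    ∃ w : Param n s → S, ∀ a, MvPolynomial.eval a f = universal w a := by
  obtain ⟨α, β, h⟩ := h.exists_slp
  refine ⟨fun θ => if θ.2.2 then β θ.1 θ.2.1 else α θ.1 θ.2.1, fun a => (h a).trans ?_⟩
  refine slp_congr (fun _ _ => rfl) (fun i hi j hj => ?_) fun i hi j hj => ?_ <;>
  · rw [paramCoeff, dif_pos (by unfold progLength; omega)]
    simp

theorem totalDegree_universal_le {τ : Type*} [Nontrivial S] (w : Param n s → MvPolynomial τ S)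
    (hw : ∀ θ, (w θ).totalDegree ≤ 1) (a : Fin n → S) :
    (universal w fun i => MvPolynomial.C (a i)).totalDegree ≤ 2 ^ progLength n s := by
  have hc : ∀ b i j, (paramCoeff w b i j).totalDegree ≤ 1 := by
    intro b i j
    unfold paramCoeff
    split
    · exact hw _
    · simp
  have := totalDegree_slp_le (N := n + 1) (base := initial fun i => MvPolynomial.C (a i)) (fun k => by
      rw [← map_initial MvPolynomial.C a k, MvPolynomial.totalDegree_C]) (hc false) (hc true)
      (n + 1 + s)
  rw [show n + 1 + s + 1 = progLength n s by unfold progLength; omega] at this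
  exact le_trans (Nat.le_add_right _ 2) this

end

/-- The number of bits of a parameter. -/
abbrev paramBits (n s : ℕ) : ℕ := 8 * progLength n s

/-- The indices of the coordinates used by the equation: one for every bit of a parameter, and
one more. -/
abbrev Coordinate (n s : ℕ) : Type := Option (Param n s × Fin (paramBits n s))

variable {n s : ℕ}

theorem card_coordinate (n s : ℕ) :
    Fintype.card (Coordinate n s) = 16 * progLength n s ^ 3 + 1 := by
  simp only [Fintype.card_option, Fintype.card_prod, Fintype.card_fin, Fintype.card_bool]
  ring

/-- The numbers whose bits are the values of the given functions. -/
def binaryParam {S : Type*} [CommRing S] (y : Coordinate n s → S) (θ : Param n s) : S :=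
  ∑ l : Fin (paramBits n s), y (some (θ, l)) * 2 ^ (l : ℕ)

/-- The matrix of the linear conditions on the coefficients of a multilinear polynomial which say
that it vanishes on the values of the universal polynomial at the points `a`. -/
def conditionMatrix (a : Coordinate n s → Fin n → ℕ) :
    Matrix (Coordinate n s → Bool) (Coordinate n s → Bool) ℤ := fun y e =>
  ∏ k, (bits e k * universal (binaryParam (bits y)) (fun i => (a k i : ℤ)) + (1 - bits e k))

/-- The row index has a bit `none` that encodes no parameter, so rows differing only there coincide.
-/
theorem conditionMatrix_det (a : Coordinate n s → Fin n → ℕ) : (conditionMatrix a).det = 0 := by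
  refine Matrix.det_zero_of_row_eq (i := fun _ => false) (j := fun k => k.isNone) ?_ ?_
  · intro h
    simpa using congrFun h none
  · funext e
    unfold conditionMatrix
    refine prod_congr rfl fun k _ => ?_
    congr 3

theorem conditionMatrix_cost {V : Type*} {d : ℕ} (a : Coordinate n s → Fin n → ℕ)
    (ha : ∀ k i, a k i ≤ d) (y e : Coordinate n s → V) :
    ∃ f, Cost ∅ ((16 * progLength n s ^ 3 + 1) * (progLength n s * (d + 2 + progLength n s *
        (2 * (paramBits n s * (paramBits n s * 3 + 3) + 2) + 6) + 6) + 9)) f ∧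
      ∀ τ y' e', (∀ k, τ (y k) = bits y' k) → (∀ k, τ (e k) = bits e' k) →
        f τ = conditionMatrix a y' e' := by
  refine ⟨∏ k, (coord (e k) * universal (binaryParam fun k => coord (y k))
    (fun i => (a k i : PolyFun V)) + (1 - coord (e k))), ?_, ?_⟩
  · have hw : ∀ θ, Cost (∅ : Set (PolyFun V)) (paramBits n s * (paramBits n s * 3 + 3) + 2)
        (binaryParam (fun k => coord (y k)) θ) := by
      intro θ
      refine (Cost.finset_sum (t := paramBits n s * 3 + 2) univ _ fun l _ => ?_).mono (by simp)
      refine ((Cost.coord _).mul (Cost.two_pow (l : ℕ))).mono ?_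
      have := l.2
      omega
    have hc : ∀ b i j, Cost (∅ : Set (PolyFun V))
        (paramBits n s * (paramBits n s * 3 + 3) + 2)
        (paramCoeff (binaryParam (n := n) (s := s) fun k => coord (y k)) b i j) := by
      intro b i j
      unfold paramCoeff
      split
      · exact hw _
      · exact Cost.zero.mono (Nat.le_add_left _ _)
    have hb : ∀ k l, Cost (∅ : Set (PolyFun V)) (d + 2)
        (initial (fun i => (a k i : PolyFun V)) l) := by
      intro k l
      cases l with
      | zero => exact Cost.one.mono (Nat.zero_le _)
      | succ l =>
        by_cases h : l < n
        · rw [initial, dif_pos h]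
          exact (Cost.natCast _).mono (Nat.add_le_add_right (ha k _) 2)
        · rw [initial, dif_neg h]
          exact Cost.zero.mono (Nat.le_add_left _ _)
    rw [← card_coordinate, ← card_univ]
    refine Cost.finset_prod univ _ fun k _ => ?_
    have hU := (Builds.slp (N := n + 1) (hb k) (hc false) (hc true)
      (le_refl (progLength n s))).cost (f := universal (binaryParam fun k => coord (y k))
        (fun i => (a k i : PolyFun V))) ⟨n + 1 + s, by unfold progLength; omega, rfl⟩
    exact (((Cost.coord _).mul hU).add (Cost.one.sub (Cost.coord _))).mono (by omega)
  · intro τ y' e' hy he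
    rw [Finset.prod_apply]
    refine prod_congr rfl fun k _ => ?_
    have := map_universal (Pi.evalRingHom (fun _ : V → ℤ => ℤ) τ)
      (binaryParam (n := n) (s := s) fun k => coord (y k)) (fun i => (a k i : PolyFun V))
    rw [Pi.evalRingHom_apply] at this
    simp only [Pi.add_apply, Pi.mul_apply, Pi.sub_apply, Pi.one_apply, this]
    simp only [coord, he]
    congr 3
    · funext θ
      simp only [binaryParam, Pi.evalRingHom_apply, Finset.sum_apply, Pi.mul_apply, coord, hy]
      simp

/-- The multilinear polynomial with the coefficients `v` in the variables `pt k`. -/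
noncomputable def multilinear {κ σ : Type*} [Fintype κ] [DecidableEq κ] (pt : κ → σ)
    (v : (κ → Bool) → ℤ) : MvPolynomial σ ℤ :=
  ∑ e, MvPolynomial.C (v e) * ∏ k, if e k then MvPolynomial.X (pt k) else 1

section

variable {κ σ : Type*} [Fintype κ] [DecidableEq κ]

theorem aeval_multilinear {S : Type*} [CommRing S] (pt : κ → σ) (v : (κ → Bool) → ℤ) (τ : σ → S) :
    MvPolynomial.aeval τ (multilinear pt v) = ∑ e, (v e : S) * ∏ k, if e k then τ (pt k) else 1 := by
  simp [multilinear, map_sum, map_prod, apply_ite (MvPolynomial.aeval τ)]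

/-- Evaluate at the indicator vector of a minimal exponent `e` with nonzero coefficient: only
monomials below `e` survive, and among these only `e` has a nonzero coefficient. -/
theorem multilinear_ne_zero {pt : κ → σ} (hpt : Function.Injective pt) {v : (κ → Bool) → ℤ}
    (hv : v ≠ 0) : multilinear pt v ≠ 0 := by
  intro h
  obtain ⟨e', he'⟩ := Function.ne_iff.1 hv
  obtain ⟨e, -, hmin⟩ := (Set.toFinite {e | v e ≠ 0}).exists_le_minimal he'
  have h1 := aeval_multilinear pt v (Function.extend pt (bits e) 0)
  rw [h, map_zero, sum_eq_single e] at h1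
  · simp only [hpt.extend_apply, bits] at h1
    rw [prod_eq_one fun k _ => by cases e k <;> simp, mul_one] at h1
    exact hmin.prop (by simpa using h1.symm)
  · intro b _ hb
    by_cases hle : b ≤ e
    · have : v b = 0 := by
        by_contra hb0
        exact hb (le_antisymm hle (hmin.le_of_le hb0 hle))
      simp [this]
    · obtain ⟨k, hk⟩ := not_forall.1 hle
      rw [prod_eq_zero (mem_univ k), mul_zero]
      rw [hpt.extend_apply, bits]
      revert hk
      cases b k <;> cases e k <;> simp
  · simp

theorem isMultilinear_multilinear {pt : κ → σ} (hpt : Function.Injective pt)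
    (v : (κ → Bool) → ℤ) : IsMultilinear (multilinear pt v) := by
  classical
  intro i
  refine (MvPolynomial.degreeOf_sum_le _ _ _).trans (Finset.sup_le fun e _ => ?_)
  refine (MvPolynomial.degreeOf_C_mul_le _ _ _).trans
    ((MvPolynomial.degreeOf_prod_le _ _ _).trans ?_)
  calc ∑ k, MvPolynomial.degreeOf i (if e k then MvPolynomial.X (pt k) else 1)
      ≤ ∑ k, if i = pt k then 1 else 0 := by
        refine sum_le_sum fun k _ => ?_
        split
        · rw [MvPolynomial.degreeOf_X]
        · rw [MvPolynomial.degreeOf_one]; exact Nat.zero_le _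
    _ ≤ 1 := by
        rw [sum_boole, Nat.cast_id, card_le_one]
        intro k hk l hl
        exact hpt ((mem_filter.1 hk).2.symm.trans (mem_filter.1 hl).2)

end

/-- The left side bounds the degree of `conditionPoly`: one factor of degree at most `2 ^ p` per
coordinate. The right side is the number of values of a parameter with `8 * p` bits. -/
theorem bits_pow_bound (p : ℕ) (hp : 2 ≤ p) : (16 * p ^ 3 + 1) * 2 ^ p < 2 ^ (8 * p) := by
  have h1 : p ^ 3 ≤ (2 ^ p) ^ 3 := Nat.pow_le_pow_left Nat.lt_two_pow_self.le 3
  have h2 : 4 ≤ 2 ^ p := (Nat.pow_le_pow_right two_pos hp : 2 ^ 2 ≤ 2 ^ p)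
  have h3 : 2 ^ (8 * p) = (2 ^ p) ^ 3 * 2 ^ p * (2 ^ p) ^ 4 := by
    rw [← pow_mul, ← pow_mul, ← pow_add, ← pow_add]; congr 1; ring
  have h4 : 4 ^ 4 ≤ (2 ^ p) ^ 4 := Nat.pow_le_pow_left h2 4
  rw [h3]
  have h5 : 0 < (2 ^ p) ^ 3 := by positivity
  have h6 : 16 * p ^ 3 + 1 < (2 ^ p) ^ 3 * 4 ^ 4 := by omega
  calc (16 * p ^ 3 + 1) * 2 ^ p < (2 ^ p) ^ 3 * 4 ^ 4 * 2 ^ p :=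
        Nat.mul_lt_mul_of_pos_right h6 (by positivity)
    _ = (2 ^ p) ^ 3 * 2 ^ p * 4 ^ 4 := by ring
    _ ≤ _ := Nat.mul_le_mul_left _ h4

/-- The multilinear polynomial with the coefficients `v` at the values of the universal polynomial
with indeterminate parameters. -/
noncomputable def conditionPoly (a : Coordinate n s → Fin n → ℕ)
    (v : (Coordinate n s → Bool) → ℤ) : MvPolynomial (Param n s) ℤ :=
  ∑ e, MvPolynomial.C (v e) * ∏ k,
    if e k then universal MvPolynomial.X (fun i => MvPolynomial.C (a k i : ℤ)) else 1

theorem aeval_conditionPoly {S : Type*} [CommRing S] (a : Coordinate n s → Fin n → ℕ)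
    (v : (Coordinate n s → Bool) → ℤ) (w : Param n s → S) :
    MvPolynomial.aeval w (conditionPoly a v) =
      ∑ e, (v e : S) * ∏ k, (if e k then universal w (fun i => (a k i : S)) else 1) := by
  have h : ∀ k, MvPolynomial.aeval w (universal (MvPolynomial.X : Param n s → _)
      (fun i => MvPolynomial.C (a k i : ℤ))) = universal w (fun i => (a k i : S)) := by
    intro k
    have := map_universal ((MvPolynomial.aeval w : MvPolynomial (Param n s) ℤ →ₐ[ℤ] S) :
      MvPolynomial (Param n s) ℤ →+* S) MvPolynomial.X (fun i => MvPolynomial.C (a k i : ℤ))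
    simpa using this
  simp only [conditionPoly, map_sum, map_mul, map_prod, apply_ite (MvPolynomial.aeval w), h,
    map_one, MvPolynomial.aeval_C, algebraMap_int_eq, Int.coe_castRingHom]

/-- A kernel vector of the condition matrix gives a multilinear polynomial that vanishes on the
values of the universal polynomial, for all parameters. -/
theorem sum_universal_eq_zero {S : Type*} [CommRing S] {a : Coordinate n s → Fin n → ℕ}
    {v : (Coordinate n s → Bool) → ℤ} (hv : conditionMatrix a *ᵥ v = 0) (w : Param n s → S) :
    ∑ e, (v e : S) * ∏ k, (if e k then universal w (fun i => (a k i : S)) else 1) = 0 := by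
  classical
  suffices conditionPoly a v = 0 by rw [← aeval_conditionPoly, this, map_zero]
  set B := paramBits n s with hB
  -- Vanishing on a grid with more points in each direction than the degree forces an identity over
  -- `ℤ`, which then specializes to parameters in any commutative ring, in particular `ℂ`.
  refine MvPolynomial.eq_zero_of_eval_zero_at_prod_finset _
    (fun _ => (range (2 ^ B)).image fun m : ℕ => (m : ℤ)) (fun θ => ?_) fun x hx => ?_
  · rw [card_image_of_injective _ Nat.cast_injective, card_range]
    refine lt_of_le_of_lt ((MvPolynomial.degreeOf_le_totalDegree _ θ).trans ?_)
      (bits_pow_bound (progLength n s) (Nat.le_add_left 2 _))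
    refine MvPolynomial.totalDegree_finsetSum_le fun e _ => ?_
    refine (MvPolynomial.totalDegree_mul _ _).trans ?_
    rw [MvPolynomial.totalDegree_C, zero_add, ← card_coordinate, ← card_univ, ← smul_eq_mul,
      ← sum_const]
    refine (MvPolynomial.totalDegree_finsetProd _ _).trans (sum_le_sum fun k _ => ?_)
    split
    · exact totalDegree_universal_le _ (fun θ => (MvPolynomial.totalDegree_X θ).le) _
    · rw [MvPolynomial.totalDegree_one]; exact Nat.zero_le _
  · have hx' : ∀ θ, ∃ m : ℕ, m < 2 ^ B ∧ (m : ℤ) = x θ := fun θ => by simpa using hx θ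
    choose m hm hmx using hx'
    -- The row of the grid point lists the binary digits of its coordinates; the dummy bit may be
    -- anything.
    set y : Coordinate n s → Bool := fun k => k.elim false fun p => (m p.1).testBit p.2 with hy
    have hyx : binaryParam (bits y) = x := by
      funext θ
      rw [binaryParam, ← hmx, ← Nat.mod_eq_of_lt (hm θ), ← sum_testBit]
      push_cast
      exact Fin.sum_univ_eq_sum_range (fun l => (((m θ).testBit l).toNat : ℤ) * 2 ^ l) B
    have h1 := congrFun hv y
    have h2 := aeval_conditionPoly a v x
    rw [MvPolynomial.aeval_eq_eval] at h2
    refine h2.trans (Eq.trans ?_ h1)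
    rw [mulVec, dotProduct]
    refine sum_congr rfl fun e _ => ?_
    rw [mul_comm, conditionMatrix, hyx]
    congr 1
    refine prod_congr rfl fun k _ => ?_
    unfold bits
    cases e k <;> simp

/-- Stars and bars: the multiplicity of the last symbol is the slack in the degree bound. -/
theorem exists_injective_sym_evalPoint (n d : ℕ) :
    ∃ f : Sym (Fin (n + 1)) d → EvalPoint n d, Function.Injective f := by
  classical
  have hsum : ∀ m : Sym (Fin (n + 1)) d, ∑ i, (m : Multiset (Fin (n + 1))).count i = d := by
    intro m
    rw [Multiset.sum_count_eq_card (fun a _ => mem_univ a), Sym.card_coe]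
  refine ⟨fun m => ⟨fun i => (m : Multiset (Fin (n + 1))).count i.castSucc, ?_⟩, ?_⟩
  · have := hsum m
    rw [Fin.sum_univ_castSucc] at this
    dsimp only
    omega
  · intro m m' h
    have h' : ∀ i : Fin n, (m : Multiset (Fin (n + 1))).count i.castSucc =
        (m' : Multiset (Fin (n + 1))).count i.castSucc := fun i =>
      congrFun (congrArg Subtype.val h) i
    refine Sym.coe_injective (Multiset.ext.2 fun i => ?_)
    refine Fin.lastCases ?_ h' i
    have h1 := hsum m
    have h2 := hsum m'
    rw [Fin.sum_univ_castSucc] at h1 h2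
    simp only [h'] at h1
    omega

theorem exists_embedding_evalPoint {κ : Type*} [Fintype κ] {n d : ℕ}
    (h : Fintype.card κ ≤ (n + d).choose n) :
    ∃ pt : κ → EvalPoint n d, Function.Injective pt := by
  obtain ⟨f, hf⟩ := exists_injective_sym_evalPoint n d
  have hcard : Fintype.card (Sym (Fin (n + 1)) d) = (n + d).choose n := by
    rw [Sym.card_sym_eq_choose, Fintype.card_fin, show n + 1 + d - 1 = n + d by omega,
      Nat.choose_symm_add]
  obtain ⟨g⟩ := Function.Embedding.nonempty_of_card_le (h.trans hcard.ge)
  exact ⟨f ∘ g, hf.comp g.injective⟩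

/-- An equation for the evaluation vectors of small circuits, with an explicit size bound. -/
theorem exists_equation (n d s : ℕ) (h : 16 * progLength n s ^ 3 + 1 ≤ (n + d).choose n) :
    ∃ A : MvPolynomial (EvalPoint n d) ℤ, IsEquationFor A (evalVectors n d s) ∧
      IsMultilinear A ∧ ComputableConstantFreeProj A
        (18 * ((16 * progLength n s ^ 3 + 1) * (progLength n s * (d + 2 + progLength n s *
        (2 * (paramBits n s * (paramBits n s * 3 + 3) + 2) + 6) + 6) + 9)) +
        1200 * (16 * progLength n s ^ 3 + 1 + 1) ^ 2) := by
  obtain ⟨pt, hpt⟩ := exists_embedding_evalPoint (κ := Coordinate n s) (d := d)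
    ((card_coordinate n s).trans_le h)
  have ha : ∀ k i, (pt k).1 i ≤ d := fun k i =>
    (single_le_sum (fun _ _ => Nat.zero_le _) (mem_univ i)).trans (pt k).2
  obtain ⟨v, hv0, hv, hcost⟩ := exists_kernel_cost (conditionMatrix fun k => (pt k).1)
    -- The required nonzero entry belongs to the exponent vector zero: it is an empty monomial,
    -- equal to `1`.
    (conditionMatrix_det _) (by simp [conditionMatrix, bits]) pt
    (conditionMatrix_cost (fun k => (pt k).1) ha)
  refine ⟨multilinear pt v, ⟨multilinear_ne_zero hpt hv0, ?_⟩, isMultilinear_multilinear hpt v, ?_⟩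
  · rintro _ ⟨f, -, hf, rfl⟩
    obtain ⟨w, hw⟩ := hf.exists_universal
    rw [aeval_multilinear]
    simpa only [evalVector, hw] using sum_universal_eq_zero hv w
  · obtain ⟨j, hj⟩ := Countable.exists_injective_nat
      (Fin 3 × (Coordinate n s ⊕ Coordinate n s) ⊕ ℕ)
    rw [card_coordinate] at hcost
    refine computable_of_cost j hj _ ?_
    convert hcost using 2 with τ
    rw [← MvPolynomial.aeval_eq_eval]
    exact aeval_multilinear pt v _

end Equation

/-! ### Numerical bounds and conclusion -/

theorem size_bound {p d x : ℕ} (hx : 8 ≤ x) (hp : p ≤ 2 * x) (hd : d ≤ x) :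
    18 * ((16 * p ^ 3 + 1) * (p * (d + 2 + p *
        (2 * (8 * p * (8 * p * 3 + 3) + 2) + 6) + 6) + 9)) +
        1200 * (16 * p ^ 3 + 1 + 1) ^ 2 ≤ x ^ 17 := by
  have h1 : 2 * (8 * p * (8 * p * 3 + 3) + 2) + 6 ≤ 1700 * x ^ 2 := by
    calc 2 * (8 * p * (8 * p * 3 + 3) + 2) + 6
        ≤ 2 * (8 * (2 * x) * (8 * (2 * x) * 3 + 3) + 2) + 6 := by gcongr
      _ ≤ 1700 * x ^ 2 := by nlinarith
  have h2 : p * (d + 2 + p * (2 * (8 * p * (8 * p * 3 + 3) + 2) + 6) + 6) + 9 ≤ 7000 * x ^ 4 := by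
    calc p * (d + 2 + p * (2 * (8 * p * (8 * p * 3 + 3) + 2) + 6) + 6) + 9
        ≤ (2 * x) * (x + 2 + (2 * x) * (1700 * x ^ 2) + 6) + 9 := by gcongr
      _ = 6800 * x ^ 4 + (2 * x ^ 2 + 16 * x + 9) := by ring
      _ ≤ 6800 * x ^ 4 + 200 * x ^ 4 := by
          have : 1 ≤ x ^ 2 := Nat.one_le_pow _ _ (by omega)
          have h4 : x ^ 2 ≤ x ^ 4 := Nat.pow_le_pow_right (by omega) (by norm_num)
          nlinarith
      _ = 7000 * x ^ 4 := by ring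
  have h3 : 16 * p ^ 3 + 1 + 1 ≤ 130 * x ^ 3 := by
    calc 16 * p ^ 3 + 1 + 1 ≤ 16 * (2 * x) ^ 3 + 1 + 1 := by gcongr
      _ = 128 * x ^ 3 + 2 := by ring
      _ ≤ 130 * x ^ 3 := by
          have : 1 ≤ x ^ 3 := Nat.one_le_pow _ _ (by omega)
          omega
  calc _ ≤ 18 * ((130 * x ^ 3) * (7000 * x ^ 4)) + 1200 * (130 * x ^ 3) ^ 2 := by
        gcongr
        omega
    _ = 16380000 * x ^ 7 + 20280000 * x ^ 6 := by ring
    _ ≤ 16380000 * x ^ 7 + 20280000 * x ^ 7 := by gcongr <;> omega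
    _ = 36660000 * x ^ 7 := by ring
    -- The constant is absorbed by ten further powers of `x`, which is at least `8`; this fixes the
    -- exponent `17`.
    _ ≤ 8 ^ 10 * x ^ 7 := by gcongr; norm_num
    _ ≤ x ^ 10 * x ^ 7 := by gcongr
    _ = x ^ 17 := by ring

end AlgebraicCircuit

theorem mainTheorem11 :
    ∃ c n₀ : ℕ, ∀ n d s : ℕ, n₀ ≤ n → n₀ ≤ d → n₀ ≤ s →
      (n * d * s) ^ c ≤ (n + d).choose n →
      ∃ A : MvPolynomial (AlgebraicCircuit.EvalPoint n d) ℤ,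
        AlgebraicCircuit.IsEquationFor A (AlgebraicCircuit.evalVectors n d s) ∧
        AlgebraicCircuit.IsMultilinear A ∧
        AlgebraicCircuit.ComputableConstantFreeProj A ((n * d * s) ^ c) := by
  refine ⟨17, 2, fun n d s hn hd hs h => ?_⟩
  have hns : 4 ≤ n * s := Nat.mul_le_mul hn hs
  have hx : n * d * s = n * s * d := by ring
  have h8 : 8 ≤ n * d * s := hx ▸ Nat.mul_le_mul hns hd
  have hp : AlgebraicCircuit.progLength n s ≤ 2 * (n * d * s) := by
    have : n + s ≤ n * s := by nlinarith
    have : n * s ≤ n * d * s := hx ▸ Nat.le_mul_of_pos_right _ (by omega)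
    unfold AlgebraicCircuit.progLength
    omega
  have hd' : d ≤ n * d * s := hx ▸ Nat.le_mul_of_pos_left _ (by omega)
  have hbound := AlgebraicCircuit.size_bound h8 hp hd'
  -- The number of coordinates needed is itself below the size bound, so the hypothesis on the
  -- binomial coefficient supplies enough interpolation points.
  obtain ⟨A, h1, h2, Γ, h3, h4, h5⟩ := AlgebraicCircuit.exists_equation n d s (by
    refine le_trans ?_ (hbound.trans h)
    refine le_trans ?_ (Nat.le_add_left _ _)
    nlinarith [Nat.zero_le (16 * AlgebraicCircuit.progLength n s ^ 3)])
  exact ⟨A, h1, h2, Γ, h3, h4.trans hbound, h5⟩
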